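/- **Setting.** Let $d\ge 1$, $K\in\mathbb N$, $L,B\ge 1$, $R\ge 0$, $0<\delta<1$, $\zeta\in\mathbb R$. In round $k=1,\dots,K$ an agent receives a (possibly random) decision set $\mathcal D_k\subset\mathbb R^d$, selects an arm $x_k\in\mathcal D_k$ and observes $r_k=r(x_k)+\varepsilon_k$. Here $r$ is a deterministic function with, for all $x$ in the decision sets, $\|x\|_2\le L$, $r(x)\in[0,1]$ and $|r(x)-x^\top\theta^*|\le\zeta$, where $\theta^*\in\mathbb R^d$, $\|\theta^*\|_2\le B$. The noise is conditionally $R$-sub-Gaussian: $\mathbb E[e^{s\varepsilon_k}\mid x_1,\dots,x_k,\varepsilon_1,\dots,\varepsilon_{k-1}]\le e^{s^2R^2/2}$ almost surely for all $s\in\mathbb R$ and $k\le K$. Put $r_k^*=\sup_{x\in\mathcal D_k}r(x)$, $\mathrm{Regret}(K)=\sum_{k=1}^K(r_k^*-r(x_k))$, and let $\Delta=\inf\{r_k^*-r(x): k\le K,\ x\in\mathcal D_k,\ r_k^*-r(x)>0\}$ (over all realizations, if the decision sets are random) be the minimal sub-optimality gap; assume that this set is non-empty and $\Delta>0$. **Algorithm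 (DS-OFUL with parameters $\lambda,\Gamma,\beta$).** Start with $\mathcal C_0=\emptyset$. In round $k$ let $U_k=\lambda I+\sum_{i\in\mathcal C_{k-1}}x_ix_i^\top$ and $\theta_k=U_k^{-1}\sum_{i\in\mathcal C_{k-1}}r_ix_i$, and choose $x_k\in\arg\max_{x\in\mathcal D_k}\{x^\top\theta_k+\beta\|x\|_{U_k^{-1}}\}$, where $\|x\|_A=\sqrt{x^\top Ax}$. Set $\mathcal C_k=\mathcal C_{k-1}\cup\{k\}$ if $\|x_k\|_{U_k^{-1}}\ge\Gamma$, and $\mathcal C_k=\mathcal C_{k-1}$ otherwise. **Theorem (Upper bound).** Let $\lambda=B^{-2}$ and $\Gamma=\Delta/(2\sqrt d\,\iota_1)$ with $\iota_1=(24+18R)\log((72+54R)LB\sqrt d\,\Delta^{-1})+\sqrt{8R^2\log(1/\delta)}$. Set $\beta=1+4\sqrt{d\iota_2}+R\sqrt{2d\iota_3}$ with $\iota_2=\log(3LB\Gamma^{-1})$ and $\iota_3=\log((1+16L^2B^2\Gamma^{-2}\iota_2)/\delta)$. If $2\sqrt d\,\zeta\,\iota_1\le\Delta$, then with probability at least $1-\delta$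 the regret of DS-OFUL satisfies $$\mathrm{Regret}(K)\le\frac{32\,\beta\sqrt{2d^3\iota_2\log(1+16dL^2B^2\Gamma^{-2}\iota_2)}\;\iota_1}{\Delta}.$$ If moreover $LB\le 16d\,\Gamma^{-2}\iota_2$, then also, with probability at least $1-\delta$, $$\mathrm{Regret}(K)\le\frac{32\,\beta\sqrt{2d^3\iota_2\log(1+16d\,\Gamma^{-2}\iota_2)}\;\iota_1}{\Delta}.$$ These bounds do not depend on $K$ and are $\tilde O(d^2/\Delta)$: there are absolute constants $C>0$ and $p\in\mathbb N$ such that, for all $d\ge1$, $L,B\ge1$, $R\ge0$, $0<\Delta\le1$ and $0<\delta<1$, the right-hand side of the first bound (and hence that of the second) is at most $C(1+R)^2\,\frac{d^2}{\Delta}\,\log^p\!\big(2+\tfrac{(1+R)dLB}{\Delta\delta}\big)$. -/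

import Mathlib

open MeasureTheory ProbabilityTheory
open scoped Matrix

noncomputable section

namespace DSOFUL

/-- `ℝ^d` with its Euclidean norm. -/
abbrev Vec (d : ℕ) : Type := EuclideanSpace ℝ (Fin d)

/-! ### The algorithm, along one realization of the arms `x 1, x 2, …` and rewards `y 1, y 2, …` -/

/-- The regularized Gram matrix `lam • I + ∑ i ∈ C, x i (x i)ᵀ`. -/
def gram {d : ℕ} (lam : ℝ) (x : ℕ → Vec d) (C : Finset ℕ) : Matrix (Fin d) (Fin d) ℝ :=
  lam • (1 : Matrix (Fin d) (Fin d) ℝ) + ∑ i ∈ C, Matrix.vecMulVec (x i).ofLp (x i).ofLp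

/-- The weighted norm `‖v‖_A = √(vᵀ A v)`. -/
def wnorm {d : ℕ} (A : Matrix (Fin d) (Fin d) ℝ) (v : Vec d) : ℝ :=
  Real.sqrt (v.ofLp ⬝ᵥ (A *ᵥ v.ofLp))

open Classical in
/-- The set `C_k` of rounds selected for regression up to round `k`: `C_0 = ∅`, and round `k + 1`
is added iff the bonus of the arm `x (k + 1)`, computed from `C_k`, is at least `Γ`. -/
def selected {d : ℕ} (lam Γ : ℝ) (x : ℕ → Vec d) : ℕ → Finset ℕ
  | 0 => ∅
  | k + 1 =>
    if Γ ≤ wnorm (gram lam x (selected lam Γ x k))⁻¹ (x (k + 1)) then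
      insert (k + 1) (selected lam Γ x k)
    else selected lam Γ x k

/-- `U_k = lam • I + ∑ i ∈ C_{k-1}, x i (x i)ᵀ`, for rounds `k ≥ 1`. -/
def design {d : ℕ} (lam Γ : ℝ) (x : ℕ → Vec d) (k : ℕ) : Matrix (Fin d) (Fin d) ℝ :=
  gram lam x (selected lam Γ x (k - 1))

/-- The ridge estimate `θ_k = U_k⁻¹ ∑ i ∈ C_{k-1}, y i • x i`, for rounds `k ≥ 1`. -/
def estimate {d : ℕ} (lam Γ : ℝ) (x : ℕ → Vec d) (y : ℕ → ℝ) (k : ℕ) : Vec d :=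
  WithLp.toLp 2
    ((design lam Γ x k)⁻¹ *ᵥ (∑ i ∈ selected lam Γ x (k - 1), y i • x i).ofLp)

/-- The optimistic index `vᵀ θ_k + β ‖v‖_{U_k⁻¹}` of an arm `v` in round `k`. -/
def ucb {d : ℕ} (lam Γ β : ℝ) (x : ℕ → Vec d) (y : ℕ → ℝ) (k : ℕ) (v : Vec d) : ℝ :=
  inner ℝ v (estimate lam Γ x y k) + β * wnorm (design lam Γ x k)⁻¹ v

/-- The arms `x 1, …, x K` are those of a run of DS-OFUL with parameters `lam`, `Γ`, `β` on the
decision sets `D 1, …, D K` when the observed rewards are `y 1, …, y K`: in each round the chosen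
arm maximizes the optimistic index over the decision set (ties are broken arbitrarily). -/
def IsRun {d : ℕ} (lam Γ β : ℝ) (K : ℕ) (D : ℕ → Set (Vec d)) (x : ℕ → Vec d) (y : ℕ → ℝ) :
    Prop :=
  ∀ k ∈ Finset.Icc 1 K, x k ∈ D k ∧ ∀ v ∈ D k, ucb lam Γ β x y k v ≤ ucb lam Γ β x y k (x k)

/-! ### Rewards, gaps, regret -/

/-- The optimal expected reward over a decision set. -/
def optReward {d : ℕ} (r : Vec d → ℝ) (S : Set (Vec d)) : ℝ := sSup (r '' S)

/-- The cumulative regret `∑_{k=1}^K (r_k^* - r(x_k))`. -/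
def regret {d : ℕ} (r : Vec d → ℝ) (K : ℕ) (D : ℕ → Set (Vec d)) (x : ℕ → Vec d) : ℝ :=
  ∑ k ∈ Finset.Icc 1 K, (optReward r (D k) - r (x k))

/-- `Δ` is the minimal sub-optimality gap: the infimum of the positive gaps `r_k^* - r(v)` over the
rounds `k ∈ [K]` and the arms `v ∈ D_k` (and over all realizations, if the decision sets are
random). -/
def IsMinGap {Ω : Type*} {d : ℕ} (r : Vec d → ℝ) (K : ℕ) (D : ℕ → Ω → Set (Vec d)) (Δ : ℝ) :
    Prop :=
  IsGLB {g : ℝ | 0 < g ∧ ∃ k ∈ Finset.Icc 1 K, ∃ ω, ∃ v ∈ D k ω, g = optReward r (D k ω) - r v} Δ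

/-! ### Noise -/

/-- The σ-algebra generated by `x_1, …, x_k` and `ε_1, …, ε_{k-1}`. -/
abbrev history {Ω : Type*} {d : ℕ} (x : ℕ → Ω → Vec d) (ε : ℕ → Ω → ℝ) (k : ℕ) :
    MeasurableSpace Ω :=
  (⨆ i ∈ Finset.Icc 1 k, MeasurableSpace.comap (x i) inferInstance) ⊔
    ⨆ i ∈ Finset.Ico 1 k, MeasurableSpace.comap (ε i) inferInstance

/-- `X` is conditionally `R`-sub-Gaussian given `m`:
`𝔼[exp (s X) | m] ≤ exp (s² R² / 2)` almost surely, for every real `s`. -/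
def CondSubGaussian {Ω : Type*} (m : MeasurableSpace Ω) [MeasurableSpace Ω] (μ : Measure Ω)
    (R : ℝ) (X : Ω → ℝ) : Prop :=
  ∀ s : ℝ, Integrable (fun ω => Real.exp (s * X ω)) μ ∧
    ∀ᵐ ω ∂μ, (μ[fun ω' => Real.exp (s * X ω') | m]) ω ≤ Real.exp (s ^ 2 * R ^ 2 / 2)

/-! ### The parameters -/

/-- `ι₁ = (24 + 18 R) log ((72 + 54 R) L B √d Δ⁻¹) + √(8 R² log (1 / δ))` -/
def iota1 (d : ℕ) (L B R Δ δ : ℝ) : ℝ :=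
  (24 + 18 * R) * Real.log ((72 + 54 * R) * L * B * Real.sqrt d * Δ⁻¹) +
    Real.sqrt (8 * R ^ 2 * Real.log (1 / δ))

/-- `Γ = Δ / (2 √d ι₁)` -/
def threshold (d : ℕ) (L B R Δ δ : ℝ) : ℝ :=
  Δ / (2 * Real.sqrt d * iota1 d L B R Δ δ)

/-- `ι₂ = log (3 L B Γ⁻¹)` -/
def iota2 (d : ℕ) (L B R Δ δ : ℝ) : ℝ :=
  Real.log (3 * L * B * (threshold d L B R Δ δ)⁻¹)

/-- `ι₃ = log ((1 + 16 L² B² Γ⁻² ι₂) / δ)` -/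
def iota3 (d : ℕ) (L B R Δ δ : ℝ) : ℝ :=
  Real.log ((1 + 16 * L ^ 2 * B ^ 2 * ((threshold d L B R Δ δ)⁻¹) ^ 2 * iota2 d L B R Δ δ) / δ)

/-- `β = 1 + 4 √(d ι₂) + R √(2 d ι₃)` -/
def radius (d : ℕ) (L B R Δ δ : ℝ) : ℝ :=
  1 + 4 * Real.sqrt (d * iota2 d L B R Δ δ) + R * Real.sqrt (2 * d * iota3 d L B R Δ δ)

/-- `16 d Γ⁻² ι₂` -/
def sampleBound (d : ℕ) (L B R Δ δ : ℝ) : ℝ :=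
  16 * d * ((threshold d L B R Δ δ)⁻¹) ^ 2 * iota2 d L B R Δ δ

/-- `32 β √(2 d³ ι₂ log (1 + c · 16 d Γ⁻² ι₂)) ι₁ / Δ` -/
def regretBound (c : ℝ) (d : ℕ) (L B R Δ δ : ℝ) : ℝ :=
  32 * radius d L B R Δ δ *
      Real.sqrt (2 * d ^ 3 * iota2 d L B R Δ δ *
        Real.log (1 + c * sampleBound d L B R Δ δ)) *
    iota1 d L B R Δ δ / Δ

end DSOFUL

end

/-! Write `N` for `sampleBound`, `U` for the Gram matrix of the selected rounds and "bonus" for the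
`U⁻¹`-norm of the chosen arm. The threshold Γ plays two roles.

Few rounds are selected. A selected round has bonus at least Γ, while the elliptical potential lemma
bounds the sum of the truncated squared bonuses by a logarithm of the number n of selected rounds.
Hence n Γ² is at most logarithmic in n, and n ≤ N for every horizon (`card_selected_le`). The ridge
error has three parts: regularization (at most 1, as λ = B⁻² and ‖θ‖ ≤ B), misspecification (at most
ζ√n) and noise. The hypothesis on ζ says ζ ≤ Γ, so ζ√N ≤ 4√(dι₂), and β is a valid confidence radius
free of K (`abs_inner_estimate_sub_le`).

Rounds that are not selected cost nothing. By optimism a round has regret at most 2β·bonus + 2ζ. If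
the bonus is below Γ this is less than Δ, because the parameters satisfy β + 1 < √d ι₁, that is 2(β
+ 1)Γ < Δ (`radius_add_one_lt`); the minimal gap then forces zero regret. The selected rounds are
summed by Cauchy–Schwarz and the elliptical potential (`regret_le_of_forall_abs_inner_sub_le`).

The only random ingredient is the self-normalized bound for the noise
(`measure_exists_lt_quadForm_le`). It comes from the method of mixtures applied one round at a time:
`selfNormalized` is multiplied in each round by a one-dimensional Gaussian mixture of exponential
martingales with predictable mean and variance, and Ville's inequality handles all rounds at once.
-/

namespace DSOFUL

/-! ### Positive definite matrices and rank-one updates -/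

section Matrix

variable {n : Type*} [Fintype n] {U : Matrix n n ℝ}

theorem dotProduct_mulVec_nonneg_of_posDef (hU : U.PosDef) (v : n → ℝ) : 0 ≤ v ⬝ᵥ (U *ᵥ v) := by
  simpa using hU.posSemidef.dotProduct_mulVec_nonneg v

theorem dotProduct_mulVec_comm_of_posDef (hU : U.PosDef) (v w : n → ℝ) :
    v ⬝ᵥ (U *ᵥ w) = w ⬝ᵥ (U *ᵥ v) := by
  have h : Uᵀ = U := by simpa using hU.isHermitian.eq
  rw [Matrix.dotProduct_mulVec, ← Matrix.mulVec_transpose, h, dotProduct_comm]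

/-- Cauchy–Schwarz for the bilinear form of a positive definite matrix. -/
theorem sq_dotProduct_mulVec_le (hU : U.PosDef) (v w : n → ℝ) :
    (v ⬝ᵥ (U *ᵥ w)) ^ 2 ≤ (v ⬝ᵥ (U *ᵥ v)) * (w ⬝ᵥ (U *ᵥ w)) := by
  have h : ∀ t : ℝ, 0 ≤ (v ⬝ᵥ (U *ᵥ v)) * (t * t) + (2 * (v ⬝ᵥ (U *ᵥ w))) * t
      + (w ⬝ᵥ (U *ᵥ w)) := by
    intro t
    have := dotProduct_mulVec_nonneg_of_posDef hU (t • v + w)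
    simp only [Matrix.mulVec_add, Matrix.mulVec_smul, dotProduct_add, add_dotProduct,
      smul_dotProduct, dotProduct_smul, smul_eq_mul,
      dotProduct_mulVec_comm_of_posDef hU w v] at this
    linarith
  have := discrim_le_zero h
  unfold discrim at this
  linarith

theorem posDef_add_vecMulVec (hU : U.PosDef) (x : n → ℝ) :
    (U + Matrix.vecMulVec x x).PosDef :=
  hU.add_posSemidef (by simpa using Matrix.posSemidef_vecMulVec_self_star (R := ℝ) x)

variable [DecidableEq n]

theorem isUnit_det_of_posDef (hU : U.PosDef) : IsUnit U.det :=
  (Matrix.isUnit_iff_isUnit_det _).1 hU.isUnit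

theorem mulVec_inv_mulVec (hU : U.PosDef) (v : n → ℝ) : U *ᵥ (U⁻¹ *ᵥ v) = v := by
  rw [Matrix.mulVec_mulVec, Matrix.mul_nonsing_inv _ (isUnit_det_of_posDef hU), Matrix.one_mulVec]

theorem inv_mulVec_mulVec (hU : U.PosDef) (v : n → ℝ) : U⁻¹ *ᵥ (U *ᵥ v) = v := by
  rw [Matrix.mulVec_mulVec, Matrix.nonsing_inv_mul _ (isUnit_det_of_posDef hU), Matrix.one_mulVec]

theorem det_add_vecMulVec (hU : U.PosDef) (x : n → ℝ) :
    (U + Matrix.vecMulVec x x).det = U.det * (1 + x ⬝ᵥ (U⁻¹ *ᵥ x)) := by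
  rw [Matrix.vecMulVec_eq Unit, Matrix.det_add_replicateCol_mul_replicateRow
    (isUnit_det_of_posDef hU)]
  congr 1
  simp [Matrix.det_unique, Matrix.mul_assoc, Matrix.mul_apply, dotProduct, Matrix.mulVec]

/-- The effect of a rank-one update on the quadratic form of the inverse matrix. -/
theorem quadForm_inv_add_vecMulVec (hU : U.PosDef) (x S : n → ℝ) (y : ℝ) :
    (S + y • x) ⬝ᵥ ((U + Matrix.vecMulVec x x)⁻¹ *ᵥ (S + y • x)) =
      S ⬝ᵥ (U⁻¹ *ᵥ S) +
        (2 * (x ⬝ᵥ (U⁻¹ *ᵥ S)) * y + y ^ 2 * (x ⬝ᵥ (U⁻¹ *ᵥ x)) - (x ⬝ᵥ (U⁻¹ *ᵥ S)) ^ 2) /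
          (1 + x ⬝ᵥ (U⁻¹ *ᵥ x)) := by
  have hV := posDef_add_vecMulVec hU x
  have hq : 0 ≤ x ⬝ᵥ (U⁻¹ *ᵥ x) := dotProduct_mulVec_nonneg_of_posDef hU.inv x
  have hc := dotProduct_mulVec_comm_of_posDef hU.inv S x
  set q := x ⬝ᵥ (U⁻¹ *ᵥ x) with hqd
  set a := x ⬝ᵥ (U⁻¹ *ᵥ S) with ha
  -- The recursive least-squares update: the old solution is corrected along `U⁻¹ x` in proportion
  -- to the prediction error `y - a`. It is verified by multiplying by the updated matrix.
  have key : (U + Matrix.vecMulVec x x)⁻¹ *ᵥ (S + y • x) =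
      U⁻¹ *ᵥ S + ((y - a) / (1 + q)) • (U⁻¹ *ᵥ x) := by
    rw [← inv_mulVec_mulVec hV (U⁻¹ *ᵥ S + ((y - a) / (1 + q)) • (U⁻¹ *ᵥ x))]
    congr 1
    simp only [Matrix.add_mulVec, Matrix.mulVec_add, Matrix.mulVec_smul, mulVec_inv_mulVec hU,
      Matrix.vecMulVec_mulVec, ← hqd, ← ha]
    ext i
    simp only [Pi.add_apply, Pi.smul_apply, smul_eq_mul, MulOpposite.smul_eq_mul_unop,
      MulOpposite.unop_op]
    field_simp
    ring
  rw [key]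
  simp only [add_dotProduct, dotProduct_add, smul_dotProduct, dotProduct_smul, smul_eq_mul, hc,
    ← hqd, ← ha]
  field_simp
  ring

/-- The determinant of a positive definite matrix is at most the `d`-th power of the mean of
its diagonal. -/
theorem det_le_trace_div_card_pow [Nonempty n] (hU : U.PosDef) :
    U.det ≤ (U.trace / Fintype.card n) ^ Fintype.card n := by
  have hd : U.det = ∏ i, hU.isHermitian.eigenvalues i := by
    simpa using hU.isHermitian.det_eq_prod_eigenvalues
  have ht : U.trace = ∑ i, hU.isHermitian.eigenvalues i := by
    simpa using hU.isHermitian.trace_eq_sum_eigenvalues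
  -- AM–GM for the eigenvalues, with equal weights.
  have h := Real.geom_mean_le_arith_mean_weighted Finset.univ
    (fun _ => (Fintype.card n : ℝ)⁻¹) hU.isHermitian.eigenvalues (fun _ _ => by positivity)
    (by simp) (fun i _ => (hU.eigenvalues_pos i).le)
  rw [← Finset.mul_sum, ← ht, Real.finsetProd_rpow _ _ (fun i _ => (hU.eigenvalues_pos i).le),
    ← hd] at h
  calc U.det = (U.det ^ ((Fintype.card n : ℝ)⁻¹)) ^ Fintype.card n :=
        (Real.rpow_inv_natCast_pow hU.det_pos.le (by simp)).symm
    _ ≤ _ := by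
        rw [div_eq_inv_mul]
        exact pow_le_pow_left₀ (Real.rpow_nonneg hU.det_pos.le _) h _

end Matrix

/-! ### The Gram matrix of the selected rounds and the elliptical potential -/

section Gram

variable {d : ℕ} {lam Γ : ℝ} {x : ℕ → Vec d}

theorem posDef_gram (hlam : 0 < lam) (x : ℕ → Vec d) (C : Finset ℕ) : (gram lam x C).PosDef := by
  refine (Matrix.PosDef.one.smul hlam).add_posSemidef (Matrix.posSemidef_sum _ fun i _ => ?_)
  simpa using Matrix.posSemidef_vecMulVec_self_star (R := ℝ) (x i).ofLp

theorem gram_insert {C : Finset ℕ} {k : ℕ} (hk : k ∉ C) :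
    gram lam x (insert k C) = gram lam x C + Matrix.vecMulVec (x k).ofLp (x k).ofLp := by
  rw [gram, gram, Finset.sum_insert hk]
  abel

theorem gram_mulVec (C : Finset ℕ) (z : Fin d → ℝ) :
    gram lam x C *ᵥ z = lam • z + ∑ i ∈ C, ((x i).ofLp ⬝ᵥ z) • (x i).ofLp := by
  rw [gram, Matrix.add_mulVec, Matrix.smul_mulVec, Matrix.one_mulVec, Matrix.sum_mulVec]
  congr 1
  refine Finset.sum_congr rfl fun i _ => ?_
  rw [Matrix.vecMulVec_mulVec]
  simp

theorem dotProduct_gram_mulVec (C : Finset ℕ) (z : Fin d → ℝ) :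
    z ⬝ᵥ (gram lam x C *ᵥ z) = lam * (z ⬝ᵥ z) + ∑ i ∈ C, ((x i).ofLp ⬝ᵥ z) ^ 2 := by
  rw [gram_mulVec, dotProduct_add, dotProduct_smul, dotProduct_sum, smul_eq_mul]
  congr 1
  refine Finset.sum_congr rfl fun i _ => ?_
  rw [dotProduct_smul, smul_eq_mul, dotProduct_comm z, sq]

theorem dotProduct_self_eq_norm_sq (v : Vec d) : v.ofLp ⬝ᵥ v.ofLp = ‖v‖ ^ 2 := by
  rw [EuclideanSpace.real_norm_sq_eq]
  simp [dotProduct, sq]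

theorem inner_eq_dotProduct (v w : Vec d) : inner ℝ v w = v.ofLp ⬝ᵥ w.ofLp := by
  simp [PiLp.inner_apply, dotProduct, mul_comm]

theorem wnorm_nonneg (A : Matrix (Fin d) (Fin d) ℝ) (v : Vec d) : 0 ≤ wnorm A v :=
  Real.sqrt_nonneg _

theorem wnorm_inv_gram_sq (hlam : 0 < lam) (C : Finset ℕ) (v : Vec d) :
    wnorm (gram lam x C)⁻¹ v ^ 2 = v.ofLp ⬝ᵥ ((gram lam x C)⁻¹ *ᵥ v.ofLp) :=
  Real.sq_sqrt (dotProduct_mulVec_nonneg_of_posDef (posDef_gram hlam x C).inv _)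

theorem trace_gram_le {L : ℝ} {C : Finset ℕ} (hx : ∀ i ∈ C, ‖x i‖ ≤ L) :
    (gram lam x C).trace ≤ d * lam + C.card * L ^ 2 := by
  rw [gram, Matrix.trace_add, Matrix.trace_smul, Matrix.trace_one, Matrix.trace_sum]
  have : ∀ i ∈ C, (Matrix.vecMulVec (x i).ofLp (x i).ofLp).trace ≤ L ^ 2 := by
    intro i hi
    rw [Matrix.trace_vecMulVec, dotProduct_self_eq_norm_sq]
    exact pow_le_pow_left₀ (norm_nonneg _) (hx i hi) 2
  have := Finset.sum_le_card_nsmul C _ _ this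
  simp only [nsmul_eq_mul, smul_eq_mul, Fintype.card_fin] at this ⊢
  linarith

theorem log_det_gram_le {L : ℝ} {C : Finset ℕ} (hlam : 0 < lam) (hd : 1 ≤ d)
    (hx : ∀ i ∈ C, ‖x i‖ ≤ L) :
    Real.log ((gram lam x C).det) ≤
      d * Real.log lam + d * Real.log (1 + C.card * L ^ 2 / (d * lam)) := by
  have : Nonempty (Fin d) := ⟨⟨0, hd⟩⟩
  have hd' : (0 : ℝ) < d := by exact_mod_cast hd
  have hpd := posDef_gram hlam x C
  have h := det_le_trace_div_card_pow hpd
  rw [Fintype.card_fin] at h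
  have h2 : (gram lam x C).trace / d ≤ lam * (1 + C.card * L ^ 2 / (d * lam)) := by
    rw [div_le_iff₀ hd']
    refine (trace_gram_le hx).trans (le_of_eq ?_)
    field_simp
  have h3 := h.trans (pow_le_pow_left₀ (div_nonneg hpd.posSemidef.trace_nonneg hd'.le) h2 d)
  refine (Real.log_le_log hpd.det_pos h3).trans (le_of_eq ?_)
  rw [Real.log_pow, Real.log_mul hlam.ne' (by positivity)]
  ring

theorem selected_subset (lam Γ : ℝ) (x : ℕ → Vec d) (k : ℕ) :
    selected lam Γ x k ⊆ Finset.Icc 1 k := by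
  induction k with
  | zero => simp [selected]
  | succ k ih =>
    have h1 : selected lam Γ x k ⊆ Finset.Icc 1 (k + 1) :=
      ih.trans (Finset.Icc_subset_Icc_right (Nat.le_succ k))
    rw [selected]
    split_ifs
    · exact Finset.insert_subset (by simp) h1
    · exact h1

theorem succ_notMem_selected (lam Γ : ℝ) (x : ℕ → Vec d) (k : ℕ) :
    k + 1 ∉ selected lam Γ x k := fun h => by
  have := Finset.mem_Icc.1 (selected_subset lam Γ x k h)
  omega

theorem design_succ (lam Γ : ℝ) (x : ℕ → Vec d) (k : ℕ) :
    design lam Γ x (k + 1) = gram lam x (selected lam Γ x k) := rfl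

theorem mem_selected {K i : ℕ} :
    i ∈ selected lam Γ x K ↔
      i ∈ Finset.Icc 1 K ∧ Γ ≤ wnorm (design lam Γ x i)⁻¹ (x i) := by
  induction K with
  | zero => simp [selected]
  | succ k ih =>
    rw [selected]
    split_ifs with h
    · rw [Finset.mem_insert, ih]
      constructor
      · rintro (rfl | ⟨h1, h2⟩)
        · exact ⟨by simp, h⟩
        · exact ⟨Finset.Icc_subset_Icc_right (Nat.le_succ k) h1, h2⟩
      · rintro ⟨h1, h2⟩
        rcases eq_or_ne i (k + 1) with rfl | hne
        · exact Or.inl rfl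
        · refine Or.inr ⟨?_, h2⟩
          rw [Finset.mem_Icc] at h1 ⊢
          omega
    · rw [ih]
      constructor
      · rintro ⟨h1, h2⟩
        exact ⟨Finset.Icc_subset_Icc_right (Nat.le_succ k) h1, h2⟩
      · rintro ⟨h1, h2⟩
        rcases eq_or_ne i (k + 1) with rfl | hne
        · exact absurd h2 h
        · refine ⟨?_, h2⟩
          rw [Finset.mem_Icc] at h1 ⊢
          omega

/-- By the matrix determinant lemma each selected round multiplies the determinant by one plus its
squared bonus, so the logarithms telescope. -/
theorem sum_log_one_add_sq_wnorm (hlam : 0 < lam) (k : ℕ) :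
    ∑ i ∈ selected lam Γ x k, Real.log (1 + wnorm (design lam Γ x i)⁻¹ (x i) ^ 2) =
      Real.log ((gram lam x (selected lam Γ x k)).det) - d * Real.log lam := by
  induction k with
  | zero => simp [selected, gram]
  | succ k ih =>
    rw [selected]
    split_ifs with h
    · have hn := succ_notMem_selected lam Γ x k
      have hpd := posDef_gram hlam x (selected lam Γ x k)
      rw [Finset.sum_insert hn, ih, gram_insert hn, det_add_vecMulVec hpd, design_succ,
        wnorm_inv_gram_sq hlam, Real.log_mul hpd.det_pos.ne']
      · ring
      · have := dotProduct_mulVec_nonneg_of_posDef hpd.inv (x (k + 1)).ofLp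
        positivity
    · exact ih

/-- Follows from `log (1 + u) ≥ u / (1 + u)`; the truncation at 1 is what allows a constant factor.
-/
theorem min_one_le_two_mul_log_one_add {u : ℝ} (hu : 0 ≤ u) : min 1 u ≤ 2 * Real.log (1 + u) := by
  have h := Real.one_sub_inv_le_log_of_pos (by linarith : (0 : ℝ) < 1 + u)
  have h2 : min 1 u ≤ 2 * (1 - (1 + u)⁻¹) := by
    have : 2 * (1 - (1 + u)⁻¹) = 2 * u / (1 + u) := by field_simp; ring
    rw [this, le_div_iff₀ (by linarith)]
    rcases le_total 1 u with h | h
    · rw [min_eq_left h]; linarith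
    · rw [min_eq_right h]; nlinarith
  linarith

/-- The elliptical potential lemma for the selected rounds. -/
theorem sum_min_one_sq_wnorm_le {L : ℝ} (hlam : 0 < lam) (hd : 1 ≤ d) {k : ℕ}
    (hx : ∀ i ∈ selected lam Γ x k, ‖x i‖ ≤ L) :
    ∑ i ∈ selected lam Γ x k, min 1 (wnorm (design lam Γ x i)⁻¹ (x i) ^ 2) ≤
      2 * d * Real.log (1 + (selected lam Γ x k).card * L ^ 2 / (d * lam)) := by
  have h1 := Finset.sum_le_sum fun i (_ : i ∈ selected lam Γ x k) =>
    min_one_le_two_mul_log_one_add (sq_nonneg (wnorm (design lam Γ x i)⁻¹ (x i)))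
  rw [← Finset.mul_sum, sum_log_one_add_sq_wnorm hlam] at h1
  have := log_det_gram_le hlam hd hx
  linarith

end Gram

/-! ### Deterministic error decomposition of the ridge estimate -/

section Confidence

variable {d : ℕ} {lam Γ : ℝ} {x : ℕ → Vec d}

/-- The quadratic form of the inverse is the maximum over z of the concave function in the
hypothesis, attained at `U⁻¹ b`. This reduces bounds on inverse forms to inequalities without an
inverse. -/
theorem quadForm_inv_le {n : Type*} [Fintype n] [DecidableEq n] {U : Matrix n n ℝ} (hU : U.PosDef)
    {b : n → ℝ} {c : ℝ} (h : ∀ z, 2 * (b ⬝ᵥ z) - z ⬝ᵥ (U *ᵥ z) ≤ c) : b ⬝ᵥ (U⁻¹ *ᵥ b) ≤ c := by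
  have := h (U⁻¹ *ᵥ b)
  rw [mulVec_inv_mulVec hU, dotProduct_comm _ b] at this
  linarith

theorem quadForm_inv_gram_smul_le (hlam : 0 < lam) (C : Finset ℕ) (θ : Vec d) :
    (lam • θ.ofLp) ⬝ᵥ ((gram lam x C)⁻¹ *ᵥ (lam • θ.ofLp)) ≤ lam * ‖θ‖ ^ 2 := by
  refine quadForm_inv_le (posDef_gram hlam x C) fun z => ?_
  rw [dotProduct_gram_mulVec, ← dotProduct_self_eq_norm_sq, smul_dotProduct, smul_eq_mul]
  have h1 : 0 ≤ ∑ i ∈ C, ((x i).ofLp ⬝ᵥ z) ^ 2 := Finset.sum_nonneg fun _ _ => sq_nonneg _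
  have h2 : 0 ≤ (θ.ofLp - z) ⬝ᵥ (θ.ofLp - z) := by
    simpa using dotProduct_star_self_nonneg (θ.ofLp - z)
  rw [sub_dotProduct, dotProduct_sub, dotProduct_sub, dotProduct_comm z θ.ofLp] at h2
  nlinarith

/-- Termwise `2 η t ≤ η² + t²` with `t = x i ⬝ᵥ z`. For |η i| ≤ ζ the result is the ζ√n
misspecification error, the reason why the sample must stay small. -/
theorem quadForm_inv_gram_sum_le (hlam : 0 < lam) (C : Finset ℕ) (η : ℕ → ℝ) :
    (∑ i ∈ C, η i • (x i).ofLp) ⬝ᵥ ((gram lam x C)⁻¹ *ᵥ (∑ i ∈ C, η i • (x i).ofLp)) ≤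
      ∑ i ∈ C, η i ^ 2 := by
  refine quadForm_inv_le (posDef_gram hlam x C) fun z => ?_
  rw [dotProduct_gram_mulVec, sum_dotProduct, Finset.mul_sum]
  have h2 : 0 ≤ z ⬝ᵥ z := by simpa using dotProduct_star_self_nonneg z
  have h3 : ∑ i ∈ C, 2 * ((η i • (x i).ofLp) ⬝ᵥ z) ≤
      ∑ i ∈ C, (η i ^ 2 + ((x i).ofLp ⬝ᵥ z) ^ 2) := by
    refine Finset.sum_le_sum fun i _ => ?_
    rw [smul_dotProduct, smul_eq_mul]
    nlinarith [sq_nonneg (η i - (x i).ofLp ⬝ᵥ z)]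
  rw [Finset.sum_add_distrib] at h3
  nlinarith

theorem abs_dotProduct_inv_mulVec_le {C : Finset ℕ} (hlam : 0 < lam) (v : Vec d) {b : Fin d → ℝ}
    {c : ℝ} (hc : 0 ≤ c) (h : b ⬝ᵥ ((gram lam x C)⁻¹ *ᵥ b) ≤ c ^ 2) :
    |v.ofLp ⬝ᵥ ((gram lam x C)⁻¹ *ᵥ b)| ≤ c * wnorm (gram lam x C)⁻¹ v := by
  refine abs_le_of_sq_le_sq ?_ (mul_nonneg hc (wnorm_nonneg _ _))
  refine (sq_dotProduct_mulVec_le (posDef_gram hlam x C).inv _ _).trans ?_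
  rw [mul_pow, wnorm_inv_gram_sq hlam, mul_comm]
  exact mul_le_mul_of_nonneg_right h
    (dotProduct_mulVec_nonneg_of_posDef (posDef_gram hlam x C).inv _)

/-- The error of the ridge estimate for rewards that are linear up to a misspecification `η` and
a noise `e`. -/
theorem abs_inner_ridge_sub_le {C : Finset ℕ} (hlam : 0 < lam) {θ : Vec d} {y η e : ℕ → ℝ}
    {b ζ ρ : ℝ} (hy : ∀ i ∈ C, y i = inner ℝ (x i) θ + η i + e i) (hb : 0 ≤ b)
    (hθ : lam * ‖θ‖ ^ 2 ≤ b ^ 2) (hζ : 0 ≤ ζ) (hη : ∀ i ∈ C, |η i| ≤ ζ) (hρ : 0 ≤ ρ)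
    (he : (∑ i ∈ C, e i • (x i).ofLp) ⬝ᵥ ((gram lam x C)⁻¹ *ᵥ (∑ i ∈ C, e i • (x i).ofLp)) ≤
      ρ ^ 2) (v : Vec d) :
    |inner ℝ v (WithLp.toLp 2 ((gram lam x C)⁻¹ *ᵥ (∑ i ∈ C, y i • x i).ofLp)) - inner ℝ v θ| ≤
      (b + ζ * Real.sqrt C.card + ρ) * wnorm (gram lam x C)⁻¹ v := by
  have hpd := posDef_gram hlam x C
  have h1 := abs_dotProduct_inv_mulVec_le (x := x) (C := C) hlam v hb
    ((quadForm_inv_gram_smul_le hlam C θ).trans hθ)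
  have h2 := abs_dotProduct_inv_mulVec_le hlam v
    (c := ζ * Real.sqrt C.card) (by positivity)
    ((quadForm_inv_gram_sum_le (x := x) hlam C η).trans (by
      rw [mul_pow, Real.sq_sqrt (Nat.cast_nonneg _), mul_comm, ← nsmul_eq_mul]
      refine Finset.sum_le_card_nsmul _ _ _ fun i hi => ?_
      rw [← sq_abs]
      exact pow_le_pow_left₀ (abs_nonneg _) (hη i hi) 2))
  have h3 := abs_dotProduct_inv_mulVec_le hlam v hρ he
  have key : inner ℝ v (WithLp.toLp 2 ((gram lam x C)⁻¹ *ᵥ (∑ i ∈ C, y i • x i).ofLp)) -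
      inner ℝ v θ = - (v.ofLp ⬝ᵥ ((gram lam x C)⁻¹ *ᵥ (lam • θ.ofLp))) +
        v.ofLp ⬝ᵥ ((gram lam x C)⁻¹ *ᵥ (∑ i ∈ C, η i • (x i).ofLp)) +
        v.ofLp ⬝ᵥ ((gram lam x C)⁻¹ *ᵥ (∑ i ∈ C, e i • (x i).ofLp)) := by
    -- The exactly linear part of the rewards contributes `(U - lam I) θ`, whence the regularization
    -- bias `-lam U⁻¹ θ`.
    have hs : (∑ i ∈ C, y i • x i).ofLp = gram lam x C *ᵥ θ.ofLp - lam • θ.ofLp +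
        ∑ i ∈ C, η i • (x i).ofLp + ∑ i ∈ C, e i • (x i).ofLp := by
      rw [gram_mulVec, add_sub_cancel_left, ← Finset.sum_add_distrib, ← Finset.sum_add_distrib,
        WithLp.ofLp_sum]
      refine Finset.sum_congr rfl fun i hi => ?_
      rw [WithLp.ofLp_smul, hy i hi, inner_eq_dotProduct, add_smul, add_smul]
    rw [inner_eq_dotProduct, inner_eq_dotProduct, hs, Matrix.mulVec_add, Matrix.mulVec_add,
      Matrix.mulVec_sub, inv_mulVec_mulVec hpd, dotProduct_add, dotProduct_add, dotProduct_sub]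
    ring
  rw [key, abs_le]
  rw [abs_le] at h1 h2 h3
  constructor <;> nlinarith

end Confidence

/-! ### One-dimensional Gaussian mixtures of exponential martingales -/

section Mixture

/-- The value at `y` of the mixture of the exponential martingales `exp (s y - s² / 2)` over
`s ∼ N(a, q)`. -/
noncomputable def mixture (a q y : ℝ) : ℝ :=
  (Real.sqrt (1 + q))⁻¹ * Real.exp ((2 * a * y + y ^ 2 * q - a ^ 2) / (1 + q) / 2)

theorem measurable_mixture : Measurable fun p : ℝ × ℝ × ℝ => mixture p.1 p.2.1 p.2.2 := by
  unfold mixture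
  fun_prop

theorem mixture_nonneg (a q y : ℝ) : 0 ≤ mixture a q y := by
  unfold mixture
  positivity

/-- Completing the square: the tilted Gaussian density is `mixture` times the posterior density of a
Gaussian mean with prior N(a, q) after one unit-variance observation y. -/
theorem gaussianPDFReal_mul_exp (a y s : ℝ) {q : NNReal} (hq : q ≠ 0) :
    gaussianPDFReal a q s * Real.exp (s * y - s ^ 2 / 2) =
      mixture a q y * gaussianPDFReal ((a + q * y) / (1 + q)) (q / (1 + q)) s := by
  have hq' : (0 : ℝ) < q := by exact_mod_cast pos_iff_ne_zero.2 hq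
  simp only [gaussianPDFReal, mixture, NNReal.coe_div, NNReal.coe_add, NNReal.coe_one]
  have h1 : Real.sqrt (2 * Real.pi * (q / (1 + q))) =
      Real.sqrt (2 * Real.pi * q) / Real.sqrt (1 + q) := by
    rw [← Real.sqrt_div (by positivity), mul_div_assoc]
  have h2 : Real.sqrt (1 + q) ≠ 0 := by positivity
  have h3 : Real.sqrt (2 * Real.pi * q) ≠ 0 := by positivity
  rw [h1, mul_assoc, ← Real.exp_add, mul_mul_mul_comm, ← Real.exp_add]
  congr 1
  · field_simp
  · congr 1
    field_simp
    ring

theorem lintegral_exp_gaussianReal (a y : ℝ) (q : NNReal) :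
    ∫⁻ s, ENNReal.ofReal (Real.exp (s * y - s ^ 2 / 2)) ∂gaussianReal a q =
      ENNReal.ofReal (mixture a q y) := by
  by_cases hq : q = 0
  · subst hq
    rw [gaussianReal_zero_var, lintegral_dirac]
    simp only [mixture, NNReal.coe_zero, add_zero, Real.sqrt_one, inv_one, one_mul, mul_zero]
    congr 2
    ring
  · rw [gaussianReal_of_var_ne_zero a hq, lintegral_withDensity_eq_lintegral_mul _
      (measurable_gaussianPDF a q) (by fun_prop)]
    have hq1 : q / (1 + q) ≠ 0 := div_ne_zero hq (by positivity)
    have : ∀ s, (gaussianPDF a q * fun s => ENNReal.ofReal (Real.exp (s * y - s ^ 2 / 2))) s =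
        ENNReal.ofReal (mixture a q y) *
          gaussianPDF ((a + q * y) / (1 + q)) (q / (1 + q)) s := by
      intro s
      rw [Pi.mul_apply, gaussianPDF, gaussianPDF, ← ENNReal.ofReal_mul (gaussianPDFReal_nonneg _ _ _),
        ← ENNReal.ofReal_mul (mixture_nonneg _ _ _), gaussianPDFReal_mul_exp a y s hq]
    simp_rw [this]
    rw [lintegral_const_mul _ (measurable_gaussianPDF _ _), lintegral_gaussianPDF_eq_one _ hq1,
      mul_one]

/-- By Tonelli the integral over y may be taken first; for each s the integral of `exp (s y - s² /
2)` is at most 1. -/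
theorem lintegral_mixture_le_one {ν : Measure ℝ} [SFinite ν]
    (h : ∀ s : ℝ, ∫⁻ y, ENNReal.ofReal (Real.exp (s * y)) ∂ν ≤
      ENNReal.ofReal (Real.exp (s ^ 2 / 2))) (a : ℝ) {q : ℝ} (hq : 0 ≤ q) :
    ∫⁻ y, ENNReal.ofReal (mixture a q y) ∂ν ≤ 1 := by
  lift q to NNReal using hq
  simp_rw [← lintegral_exp_gaussianReal]
  rw [lintegral_lintegral_swap (by fun_prop)]
  calc _ ≤ ∫⁻ _, 1 ∂gaussianReal a q := lintegral_mono fun s => ?_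
    _ = 1 := by simp
  have : ∀ y, ENNReal.ofReal (Real.exp (s * y - s ^ 2 / 2)) =
      ENNReal.ofReal (Real.exp (-(s ^ 2 / 2))) * ENNReal.ofReal (Real.exp (s * y)) := fun y => by
    rw [← ENNReal.ofReal_mul (Real.exp_nonneg _), ← Real.exp_add]
    ring_nf
  simp_rw [this]
  rw [lintegral_const_mul _ (by fun_prop)]
  refine (mul_le_mul_right (h s) _).trans (le_of_eq ?_)
  rw [← ENNReal.ofReal_mul (Real.exp_nonneg _), ← Real.exp_add]
  simp

/-- A bound on the moment generating function extends from the rationals to the reals. -/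
theorem lintegral_exp_le_of_forall_rat {ν : Measure ℝ}
    (h : ∀ s : ℚ, ∫⁻ y, ENNReal.ofReal (Real.exp (s * y)) ∂ν ≤
      ENNReal.ofReal (Real.exp ((s : ℝ) ^ 2 / 2))) (s : ℝ) :
    ∫⁻ y, ENNReal.ofReal (Real.exp (s * y)) ∂ν ≤ ENNReal.ofReal (Real.exp (s ^ 2 / 2)) := by
  obtain ⟨v, hv, hlim⟩ := mem_closure_iff_seq_limit.1 (Rat.denseRange_cast (𝕜 := ℝ) s)
  choose u hu' using hv
  have hu : Filter.Tendsto (fun n => (u n : ℝ)) Filter.atTop (nhds s) := by simpa [hu'] using hlim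
  have h1 : Filter.Tendsto (fun n => ENNReal.ofReal (Real.exp ((u n : ℝ) ^ 2 / 2))) Filter.atTop
      (nhds (ENNReal.ofReal (Real.exp (s ^ 2 / 2)))) :=
    ENNReal.tendsto_ofReal ((Real.continuous_exp.tendsto _).comp ((hu.pow 2).div_const 2))
  have h2 : ∀ y, Filter.liminf (fun n => ENNReal.ofReal (Real.exp (u n * y))) Filter.atTop =
      ENNReal.ofReal (Real.exp (s * y)) := fun y =>
    (ENNReal.tendsto_ofReal ((Real.continuous_exp.tendsto _).comp (hu.mul_const y))).liminf_eq
  calc _ = ∫⁻ y, Filter.liminf (fun n => ENNReal.ofReal (Real.exp (u n * y))) Filter.atTop ∂ν := by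
        simp_rw [h2]
    _ ≤ Filter.liminf (fun n => ∫⁻ y, ENNReal.ofReal (Real.exp (u n * y)) ∂ν) Filter.atTop :=
        lintegral_liminf_le fun n => by fun_prop
    _ ≤ Filter.liminf (fun n => ENNReal.ofReal (Real.exp ((u n : ℝ) ^ 2 / 2))) Filter.atTop :=
        Filter.liminf_le_liminf (Filter.Eventually.of_forall fun n => h (u n))
    _ = _ := h1.liminf_eq

variable {Ω β : Type*} [MeasurableSpace Ω] [mβ : MeasurableSpace β] {μ : Measure Ω}
  [IsProbabilityMeasure μ] {X : Ω → ℝ} {Y : Ω → β}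

/-- The sub-Gaussian hypothesis has an exceptional null set for each s. A single null set serves all
rational s, and hence all real s; mixing over s requires this. -/
theorem ae_lintegral_condDistrib_exp_le (hY : Measurable Y) (hX : Measurable X)
    (h : CondSubGaussian (mβ.comap Y) μ 1 X) :
    ∀ᵐ ω ∂μ, ∀ s : ℝ, ∫⁻ y, ENNReal.ofReal (Real.exp (s * y)) ∂condDistrib X Y μ (Y ω) ≤
      ENNReal.ofReal (Real.exp (s ^ 2 / 2)) := by
  have : ∀ᵐ ω ∂μ, ∀ s : ℚ, ∫⁻ y, ENNReal.ofReal (Real.exp (s * y)) ∂condDistrib X Y μ (Y ω) ≤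
      ENNReal.ofReal (Real.exp ((s : ℝ) ^ 2 / 2)) := by
    rw [ae_all_iff]
    intro s
    obtain ⟨hi, hle⟩ := h s
    have hsm : StronglyMeasurable fun y : ℝ => Real.exp (s * y) :=
      Continuous.stronglyMeasurable (by fun_prop)
    have h1 := condExp_ae_eq_integral_condDistrib (μ := μ) hY hX.aemeasurable hsm hi
    have h2 : ∀ᵐ ω ∂μ, Integrable (fun y : ℝ => Real.exp (s * y)) (condDistrib X Y μ (Y ω)) :=
      Integrable.condDistrib_ae (f := fun p : β × ℝ => Real.exp (s * p.2)) hY.aemeasurable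
        hX.aemeasurable
        ((integrable_map_measure (by fun_prop) (by fun_prop)).2 hi)
    filter_upwards [h1, h2, hle] with ω h1 h2 h3
    rw [← ofReal_integral_eq_lintegral_ofReal h2
      (Filter.Eventually.of_forall fun _ => Real.exp_nonneg _)]
    refine ENNReal.ofReal_le_ofReal ?_
    rw [← h1]
    simpa using h3
  filter_upwards [this] with ω hω s
  exact lintegral_exp_le_of_forall_rat hω s

theorem lintegral_mul_mixture_comp_le (hY : Measurable Y) (hX : Measurable X)
    (h : CondSubGaussian (mβ.comap Y) μ 1 X) {g : β → ENNReal} {a q : β → ℝ} (hg : Measurable g)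
    (ha : Measurable a) (hq : Measurable q) (hq0 : ∀ b, 0 ≤ q b) :
    ∫⁻ ω, g (Y ω) * ENNReal.ofReal (mixture (a (Y ω)) (q (Y ω)) (X ω)) ∂μ ≤
      ∫⁻ ω, g (Y ω) ∂μ := by
  have hf : Measurable fun p : β × ℝ => ENNReal.ofReal (mixture (a p.1) (q p.1) p.2) :=
    (measurable_mixture.comp ((ha.comp measurable_fst).prodMk
      ((hq.comp measurable_fst).prodMk measurable_snd))).ennreal_ofReal
  have hgf : Measurable fun p : β × ℝ => g p.1 * ENNReal.ofReal (mixture (a p.1) (q p.1) p.2) :=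
    (hg.comp measurable_fst).mul hf
  calc _ = ∫⁻ p, g p.1 * ENNReal.ofReal (mixture (a p.1) (q p.1) p.2)
        ∂(μ.map fun ω => (Y ω, X ω)) := (lintegral_map hgf (hY.prodMk hX)).symm
    _ = ∫⁻ b, ∫⁻ y, g b * ENNReal.ofReal (mixture (a b) (q b) y) ∂condDistrib X Y μ b
          ∂(μ.map Y) := by
        rw [← compProd_map_condDistrib hX.aemeasurable, Measure.lintegral_compProd hgf]
    _ = ∫⁻ b, g b * ∫⁻ y, ENNReal.ofReal (mixture (a b) (q b) y) ∂condDistrib X Y μ b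
          ∂(μ.map Y) :=
        lintegral_congr fun b => lintegral_const_mul _ (hf.comp measurable_prodMk_left)
    _ = ∫⁻ ω, g (Y ω) * ∫⁻ y, ENNReal.ofReal (mixture (a (Y ω)) (q (Y ω)) y)
          ∂condDistrib X Y μ (Y ω) ∂μ :=
        lintegral_map (hg.mul hf.lintegral_kernel_prod_right') hY
    _ ≤ _ := by
        refine lintegral_mono_ae ?_
        filter_upwards [ae_lintegral_condDistrib_exp_le hY hX h] with ω hω
        exact mul_le_of_le_one_right' (lintegral_mixture_le_one hω _ (hq0 _))

end Mixture

/-- The one-step supermartingale property of the mixture, conditionally on a sub-σ-algebra. -/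
theorem lintegral_mul_mixture_le {Ω : Type*} {m mΩ : MeasurableSpace Ω} (hm : m ≤ mΩ)
    {μ : Measure Ω} [IsProbabilityMeasure μ] {X : Ω → ℝ} (hX : Measurable X)
    (h : CondSubGaussian m μ 1 X) {g : Ω → ENNReal} {a q : Ω → ℝ} (hg : Measurable[m] g)
    (ha : Measurable[m] a) (hq : Measurable[m] q) (hq0 : ∀ ω, 0 ≤ q ω) :
    ∫⁻ ω, g ω * ENNReal.ofReal (mixture (a ω) (q ω) (X ω)) ∂μ ≤ ∫⁻ ω, g ω ∂μ :=
  -- Conditioning on m is conditioning on the identity map into Ω equipped with m. The regular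
  -- conditional distribution is that of the real variable X, so Ω need not be standard Borel.
  lintegral_mul_mixture_comp_le (mβ := m) (Y := id) (measurable_id'' hm) hX
    (by rwa [MeasurableSpace.comap_id]) hg ha hq hq0

/-- Ville's maximal inequality over a finite horizon. -/
theorem measure_exists_le_of_setLIntegral_le {Ω : Type*} [MeasurableSpace Ω] {μ : Measure Ω}
    {K : ℕ} {Z : ℕ → Ω → ENNReal} (hZ : ∀ j ≤ K, Measurable (Z j)) (h0 : ∫⁻ ω, Z 0 ω ∂μ ≤ 1)
    {c : ENNReal}
    (h : ∀ k < K, ∫⁻ ω in {ω | ∀ j ≤ k, Z j ω < c}, Z (k + 1) ω ∂μ ≤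
      ∫⁻ ω in {ω | ∀ j ≤ k, Z j ω < c}, Z k ω ∂μ) :
    c * μ {ω | ∃ j ≤ K, c ≤ Z j ω} ≤ 1 := by
  have hmeas : ∀ k ≤ K, MeasurableSet {ω | ∀ j ≤ k, Z j ω < c} := fun k hk => by
    have : {ω | ∀ j ≤ k, Z j ω < c} = ⋂ j ∈ Set.Iic k, {ω | Z j ω < c} := by ext; simp
    rw [this]
    exact MeasurableSet.biInter (Set.to_countable _) fun j hj =>
      measurableSet_lt (hZ j (le_trans hj hk)) measurable_const
  -- Invariant: the mass that has crossed level c, counted with value c, plus the integral of Z k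
  -- over the paths that have not crossed. It plays the role of the expectation of the stopped
  -- process.
  have key : ∀ k ≤ K, c * μ {ω | ∃ j ≤ k, c ≤ Z j ω} +
      ∫⁻ ω in {ω | ∀ j ≤ k, Z j ω < c}, Z k ω ∂μ ≤ 1 := by
    intro k
    induction k with
    | zero =>
      intro _
      refine le_trans ?_ h0
      have hs : {ω | ∃ j ≤ 0, c ≤ Z j ω} = {ω | ∀ j ≤ 0, Z j ω < c}ᶜ := by ext; simp
      rw [hs, add_comm, ← lintegral_add_compl (μ := μ) (Z 0) (hmeas 0 (Nat.zero_le _))]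
      refine add_le_add (le_refl (lintegral _ _)) ?_
      rw [← setLIntegral_const]
      refine setLIntegral_mono' (hmeas 0 (Nat.zero_le _)).compl fun ω hω => ?_
      simpa using hω
    | succ k ih =>
      intro hk
      refine le_trans ?_ (ih (by omega))
      set N := {ω | ∀ j ≤ k, Z j ω < c} with hN
      have hmk := hmeas k (by omega)
      have hB : MeasurableSet {ω | c ≤ Z (k + 1) ω} := measurableSet_le measurable_const (hZ _ hk)
      have h1 : {ω | ∃ j ≤ k + 1, c ≤ Z j ω} =
          {ω | ∃ j ≤ k, c ≤ Z j ω} ∪ (N ∩ {ω | c ≤ Z (k + 1) ω}) := by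
        ext ω
        simp only [Set.mem_ofPred_eq, Set.mem_union, Set.mem_inter_iff, hN]
        constructor
        · rintro ⟨j, hj, hc⟩
          by_cases hex : ∃ j ≤ k, c ≤ Z j ω
          · exact Or.inl hex
          · push Not at hex
            rcases Nat.le_succ_iff.1 hj with hj | rfl
            · exact absurd hc (not_le.2 (hex j hj))
            · exact Or.inr ⟨hex, hc⟩
        · rintro (⟨j, hj, hc⟩ | ⟨_, hc⟩)
          · exact ⟨j, by omega, hc⟩
          · exact ⟨k + 1, le_rfl, hc⟩
      have h2 : {ω | ∀ j ≤ k + 1, Z j ω < c} = N \ {ω | c ≤ Z (k + 1) ω} := by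
        ext ω
        simp only [Set.mem_ofPred_eq, Set.mem_sdiff, hN, not_le]
        exact ⟨fun H => ⟨fun j hj => H j (by omega), H _ le_rfl⟩, fun H j hj => by
          rcases Nat.le_succ_iff.1 hj with hj | rfl
          exacts [H.1 j hj, H.2]⟩
      calc _ ≤ c * μ {ω | ∃ j ≤ k, c ≤ Z j ω} +
            (∫⁻ ω in N ∩ {ω | c ≤ Z (k + 1) ω}, Z (k + 1) ω ∂μ +
              ∫⁻ ω in N \ {ω | c ≤ Z (k + 1) ω}, Z (k + 1) ω ∂μ) := by
            rw [h1, h2, ← add_assoc]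
            gcongr
            refine (mul_le_mul_right (measure_union_le _ _) _).trans ?_
            rw [mul_add]
            gcongr
            rw [← setLIntegral_const]
            exact setLIntegral_mono' (hmk.inter hB) fun ω hω => hω.2
        _ = c * μ {ω | ∃ j ≤ k, c ≤ Z j ω} + ∫⁻ ω in N, Z (k + 1) ω ∂μ := by
            rw [lintegral_inter_add_sdiff _ _ hB]
        _ ≤ _ := by
            exact add_le_add le_rfl (h k (by omega))
  exact le_self_add.trans (key K le_rfl)

/-! ### Measurability of matrix operations -/

section MatrixMeasurability

variable {Ω n : Type*} [Fintype n] {m : MeasurableSpace Ω} {A : Ω → Matrix n n ℝ}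

theorem measurable_mulVec (hA : ∀ i j, Measurable fun ω => A ω i j) {v : Ω → n → ℝ}
    (hv : Measurable v) : Measurable fun ω => A ω *ᵥ v ω :=
  measurable_pi_lambda _ fun i => Finset.measurable_fun_sum _ fun j _ =>
    (hA i j).mul ((measurable_pi_apply j).comp hv)

theorem measurable_dotProduct {v w : Ω → n → ℝ} (hv : Measurable v) (hw : Measurable w) :
    Measurable fun ω => v ω ⬝ᵥ w ω :=
  Finset.measurable_fun_sum _ fun j _ =>
    ((measurable_pi_apply j).comp hv).mul ((measurable_pi_apply j).comp hw)

variable [DecidableEq n]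

theorem measurable_det (hA : ∀ i j, Measurable fun ω => A ω i j) :
    Measurable fun ω => (A ω).det := by
  simp_rw [Matrix.det_apply]
  exact Finset.measurable_fun_sum _ fun σ _ =>
    (Finset.measurable_fun_prod _ fun i _ => hA (σ i) i).const_smul _

theorem measurable_matrix_inv (hA : ∀ i j, Measurable fun ω => A ω i j) (i j : n) :
    Measurable fun ω => (A ω)⁻¹ i j := by
  simp_rw [Matrix.inv_def, Ring.inverse_eq_inv', Matrix.smul_apply, Matrix.adjugate_apply,
    smul_eq_mul]
  refine (measurable_det hA).inv.mul (measurable_det fun k l => ?_)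
  simp_rw [Matrix.updateRow_apply]
  split_ifs
  · exact measurable_const
  · exact hA k l

end MatrixMeasurability

/-! ### The self-normalized process and its maximal inequality -/

section SelfNormalized

variable {d : ℕ}

/-- The weighted sum `∑ i ∈ C, ξ i • x i` as a coordinate vector. -/
def weightedSum (x : ℕ → Vec d) (ξ : ℕ → ℝ) (C : Finset ℕ) : Fin d → ℝ :=
  ∑ i ∈ C, ξ i • (x i).ofLp

/-- The self-normalized supermartingale
`(det U / det (lam I))^(-1/2) * exp (‖S‖²_{U⁻¹} / 2)` after `k` rounds, where `S` is the sum of the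
noise times the arms over the selected rounds and `U` is their regularized Gram matrix. -/
noncomputable def selfNormalized (lam Γ : ℝ) (x : ℕ → Vec d) (ξ : ℕ → ℝ) (k : ℕ) : ℝ :=
  (Real.sqrt ((gram lam x (selected lam Γ x k)).det / lam ^ d))⁻¹ *
    Real.exp ((weightedSum x ξ (selected lam Γ x k) ⬝ᵥ
      ((gram lam x (selected lam Γ x k))⁻¹ *ᵥ weightedSum x ξ (selected lam Γ x k))) / 2)

variable {lam Γ : ℝ}

theorem selfNormalized_zero (hlam : 0 < lam) (x : ℕ → Vec d) (ξ : ℕ → ℝ) :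
    selfNormalized lam Γ x ξ 0 = 1 := by
  simp [selfNormalized, selected, weightedSum, gram, hlam.ne']

theorem mixture_zero_zero (y : ℝ) : mixture 0 0 y = 1 := by simp [mixture]

open Classical in
-- A selected round multiplies the process by the mixture whose mean and variance are those of the
-- next arm's linear form under N(U⁻¹ S, U⁻¹); the determinant and inverse updates supply the two
-- factors. An unselected round is the degenerate mixture with a = q = 0, equal to 1.
theorem selfNormalized_succ (hlam : 0 < lam) (x : ℕ → Vec d) (ξ : ℕ → ℝ) (k : ℕ) :
    selfNormalized lam Γ x ξ (k + 1) = selfNormalized lam Γ x ξ k *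
      mixture
        (if Γ ≤ wnorm (gram lam x (selected lam Γ x k))⁻¹ (x (k + 1)) then
          (x (k + 1)).ofLp ⬝ᵥ ((gram lam x (selected lam Γ x k))⁻¹ *ᵥ
            weightedSum x ξ (selected lam Γ x k)) else 0)
        (if Γ ≤ wnorm (gram lam x (selected lam Γ x k))⁻¹ (x (k + 1)) then
          (x (k + 1)).ofLp ⬝ᵥ ((gram lam x (selected lam Γ x k))⁻¹ *ᵥ (x (k + 1)).ofLp) else 0)
        (ξ (k + 1)) := by
  split_ifs with h
  · have hn := succ_notMem_selected lam Γ x k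
    have hpd := posDef_gram hlam x (selected lam Γ x k)
    have hq := dotProduct_mulVec_nonneg_of_posDef hpd.inv (x (k + 1)).ofLp
    have hS : weightedSum x ξ (insert (k + 1) (selected lam Γ x k)) =
        weightedSum x ξ (selected lam Γ x k) + ξ (k + 1) • (x (k + 1)).ofLp := by
      rw [weightedSum, Finset.sum_insert hn, add_comm]
      rfl
    rw [selfNormalized, selected, if_pos h, gram_insert hn, det_add_vecMulVec hpd, hS,
      quadForm_inv_add_vecMulVec hpd, selfNormalized, mixture, mul_mul_mul_comm, ← Real.exp_add,
      ← mul_inv, ← Real.sqrt_mul (div_nonneg hpd.det_pos.le (by positivity)), add_div,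
      mul_div_right_comm]
  · rw [mixture_zero_zero, mul_one, selfNormalized, selected, if_neg h, selfNormalized]

variable {Ω : Type*} {x : ℕ → Ω → Vec d} {ξ : ℕ → Ω → ℝ} {m : MeasurableSpace Ω}

open Classical in
-- The index set is random, so measurability goes through the recursion in k, whose branching
-- condition is a measurable comparison of the bonus with Γ.
theorem measurable_gram_selected {k : ℕ} (hx : ∀ i ∈ Finset.Icc 1 k, Measurable (x i))
    (a b : Fin d) :
    Measurable fun ω => gram lam (fun i => x i ω) (selected lam Γ (fun i => x i ω) k) a b := by
  induction k generalizing a b with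
  | zero => simp [selected, gram]
  | succ k ih =>
    have ih' := ih fun i hi => hx i (Finset.Icc_subset_Icc_right (Nat.le_succ k) hi)
    have hxk : Measurable fun ω => (x (k + 1) ω).ofLp :=
      (WithLp.measurable_ofLp 2 _).comp (hx (k + 1) (by simp))
    have hw : Measurable fun ω => wnorm (gram lam (fun i => x i ω)
        (selected lam Γ (fun i => x i ω) k))⁻¹ (x (k + 1) ω) :=
      (measurable_dotProduct hxk (measurable_mulVec (measurable_matrix_inv ih') hxk)).sqrt
    have : (fun ω => gram lam (fun i => x i ω) (selected lam Γ (fun i => x i ω) (k + 1)) a b) =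
        fun ω => if Γ ≤ wnorm (gram lam (fun i => x i ω)
            (selected lam Γ (fun i => x i ω) k))⁻¹ (x (k + 1) ω) then
          gram lam (fun i => x i ω) (selected lam Γ (fun i => x i ω) k) a b +
            (x (k + 1) ω).ofLp a * (x (k + 1) ω).ofLp b
        else gram lam (fun i => x i ω) (selected lam Γ (fun i => x i ω) k) a b := by
      funext ω
      rw [selected]
      split_ifs with h
      · rw [gram_insert (succ_notMem_selected _ _ _ k)]
        rfl
      · rfl
    rw [this]
    exact Measurable.ite (measurableSet_le measurable_const hw)
      ((ih' a b).add (((measurable_pi_apply a).comp hxk).mul ((measurable_pi_apply b).comp hxk)))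
      (ih' a b)

theorem measurable_wnorm_inv_gram {k : ℕ} (hx : ∀ i ∈ Finset.Icc 1 (k + 1), Measurable (x i)) :
    Measurable fun ω => wnorm (gram lam (fun i => x i ω)
        (selected lam Γ (fun i => x i ω) k))⁻¹ (x (k + 1) ω) := by
  have hxk : Measurable fun ω => (x (k + 1) ω).ofLp :=
    (WithLp.measurable_ofLp 2 _).comp (hx (k + 1) (by simp))
  exact (measurable_dotProduct hxk (measurable_mulVec (measurable_matrix_inv
    (measurable_gram_selected fun i hi =>
      hx i (Finset.Icc_subset_Icc_right (Nat.le_succ k) hi))) hxk)).sqrt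

open Classical in
theorem measurable_weightedSum_selected {k : ℕ} (hx : ∀ i ∈ Finset.Icc 1 k, Measurable (x i))
    (hξ : ∀ i ∈ Finset.Icc 1 k, Measurable (ξ i)) :
    Measurable fun ω => weightedSum (fun i => x i ω) (fun i => ξ i ω)
      (selected lam Γ (fun i => x i ω) k) := by
  induction k with
  | zero => simp [selected, weightedSum]
  | succ k ih =>
    have hsub := Finset.Icc_subset_Icc_right (a := 1) (Nat.le_succ k)
    have ih' := ih (fun i hi => hx i (hsub hi)) (fun i hi => hξ i (hsub hi))
    have hxk : Measurable fun ω => (x (k + 1) ω).ofLp :=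
      (WithLp.measurable_ofLp 2 _).comp (hx (k + 1) (by simp))
    have : (fun ω => weightedSum (fun i => x i ω) (fun i => ξ i ω)
          (selected lam Γ (fun i => x i ω) (k + 1))) =
        fun ω => if Γ ≤ wnorm (gram lam (fun i => x i ω)
            (selected lam Γ (fun i => x i ω) k))⁻¹ (x (k + 1) ω) then
          ξ (k + 1) ω • (x (k + 1) ω).ofLp + weightedSum (fun i => x i ω) (fun i => ξ i ω)
            (selected lam Γ (fun i => x i ω) k)
        else weightedSum (fun i => x i ω) (fun i => ξ i ω)
            (selected lam Γ (fun i => x i ω) k) := by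
      funext ω
      rw [selected]
      split_ifs with h
      · rw [weightedSum, Finset.sum_insert (succ_notMem_selected _ _ _ k)]
        rfl
      · rfl
    rw [this]
    exact Measurable.ite (measurableSet_le measurable_const (measurable_wnorm_inv_gram hx))
      (((hξ (k + 1) (by simp)).smul hxk).add ih') ih'

theorem measurable_selfNormalized {k : ℕ} (hx : ∀ i ∈ Finset.Icc 1 k, Measurable (x i))
    (hξ : ∀ i ∈ Finset.Icc 1 k, Measurable (ξ i)) :
    Measurable fun ω => selfNormalized lam Γ (fun i => x i ω) (fun i => ξ i ω) k := by
  have hG := measurable_gram_selected (lam := lam) (Γ := Γ) hx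
  have hS := measurable_weightedSum_selected (lam := lam) (Γ := Γ) hx hξ
  unfold selfNormalized
  exact (((measurable_det hG).div_const _).sqrt.inv).mul
    ((measurable_dotProduct hS (measurable_mulVec (measurable_matrix_inv hG) hS)).div_const _).exp

end SelfNormalized

open Classical in
/-- The self-normalized maximal inequality for noise that is conditionally `1`-sub-Gaussian. -/
theorem measure_exists_le_selfNormalized {Ω : Type*} [mΩ : MeasurableSpace Ω] {μ : Measure Ω}
    [IsProbabilityMeasure μ] {d K : ℕ} {lam Γ δ : ℝ} (hlam : 0 < lam) (hδ : 0 < δ)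
    {x : ℕ → Ω → Vec d} {ξ : ℕ → Ω → ℝ} {m : ℕ → MeasurableSpace Ω}
    (hm : ∀ k ∈ Finset.Icc 1 K, m k ≤ mΩ)
    (hx : ∀ k ∈ Finset.Icc 1 K, ∀ i ∈ Finset.Icc 1 k, Measurable[m k] (x i))
    (hξ : ∀ k ∈ Finset.Icc 1 K, ∀ i ∈ Finset.Ico 1 k, Measurable[m k] (ξ i))
    (hξm : ∀ k ∈ Finset.Icc 1 K, Measurable (ξ k))
    (hsub : ∀ k ∈ Finset.Icc 1 K, CondSubGaussian (m k) μ 1 (ξ k)) :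
    μ {ω | ∃ k ≤ K, δ⁻¹ ≤ selfNormalized lam Γ (fun i => x i ω) (fun i => ξ i ω) k} ≤
      ENNReal.ofReal δ := by
  set Z : ℕ → Ω → ENNReal := fun k ω =>
    ENNReal.ofReal (selfNormalized lam Γ (fun i => x i ω) (fun i => ξ i ω) k) with hZ
  have hpos : 0 < δ⁻¹ := inv_pos.2 hδ
  have hxm : ∀ k ∈ Finset.Icc 1 K, Measurable (x k) := fun k hk =>
    (hx k hk k (by simp [(Finset.mem_Icc.1 hk).1])).mono (hm k hk) le_rfl
  have hset : {ω | ∃ k ≤ K, δ⁻¹ ≤ selfNormalized lam Γ (fun i => x i ω) (fun i => ξ i ω) k} =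
      {ω | ∃ k ≤ K, ENNReal.ofReal δ⁻¹ ≤ Z k ω} := by
    ext ω
    simp only [Set.mem_ofPred_eq, hZ]
    refine exists_congr fun k => and_congr_right fun _ => ?_
    rw [ENNReal.ofReal_le_ofReal_iff']
    simp [hδ]
  have hZmeas : ∀ k ≤ K, Measurable (Z k) := fun k hk =>
    (measurable_selfNormalized
      (fun i hi => hxm i (Finset.Icc_subset_Icc_right hk hi))
      (fun i hi => hξm i (Finset.Icc_subset_Icc_right hk hi))).ennreal_ofReal
  have hville : ENNReal.ofReal δ⁻¹ * μ {ω | ∃ k ≤ K, ENNReal.ofReal δ⁻¹ ≤ Z k ω} ≤ 1 := by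
    refine measure_exists_le_of_setLIntegral_le hZmeas ?_ ?_
    · simp [hZ, selfNormalized_zero hlam]
    intro k hk
    have hk1 : k + 1 ∈ Finset.Icc 1 K := by rw [Finset.mem_Icc]; omega
    have hxk : ∀ i ∈ Finset.Icc 1 (k + 1), Measurable[m (k + 1)] (x i) := hx _ hk1
    have hxk' : ∀ i ∈ Finset.Icc 1 k, Measurable[m (k + 1)] (x i) := fun i hi =>
      hxk i (Finset.Icc_subset_Icc_right (Nat.le_succ k) hi)
    have hξk : ∀ i ∈ Finset.Icc 1 k, Measurable[m (k + 1)] (ξ i) := fun i hi =>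
      hξ _ hk1 i (by rw [Finset.mem_Ico]; rw [Finset.mem_Icc] at hi; omega)
    have hZm : ∀ j ≤ k, Measurable[m (k + 1)] (Z j) := fun j hj =>
      (measurable_selfNormalized
        (fun i hi => hxk' i (Finset.Icc_subset_Icc_right hj hi))
        (fun i hi => hξk i (Finset.Icc_subset_Icc_right hj hi))).ennreal_ofReal
    -- The event of no crossing up to round k involves only rounds up to k, hence is known before
    -- the noise of round k + 1; its indicator can join the predictable factor g.
    set A : Set Ω := {ω | ∀ j ≤ k, Z j ω < ENNReal.ofReal δ⁻¹} with hA
    have hAm : MeasurableSet[m (k + 1)] A := by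
      have : A = ⋂ j ∈ Set.Iic k, {ω | Z j ω < ENNReal.ofReal δ⁻¹} := by ext; simp [hA]
      rw [this]
      exact MeasurableSet.biInter (Set.to_countable _) fun j hj =>
        measurableSet_lt (hZm j hj) measurable_const
    have hAm' := hm _ hk1 _ hAm
    have hG := measurable_gram_selected (lam := lam) (Γ := Γ) hxk'
    have hS := measurable_weightedSum_selected (lam := lam) (Γ := Γ) hxk' hξk
    have hxv : Measurable[m (k + 1)] fun ω => (x (k + 1) ω).ofLp :=
      (WithLp.measurable_ofLp 2 _).comp (hxk (k + 1) (by simp))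
    have hw : MeasurableSet[m (k + 1)] {ω | Γ ≤ wnorm (gram lam (fun i => x i ω)
        (selected lam Γ (fun i => x i ω) k))⁻¹ (x (k + 1) ω)} :=
      measurableSet_le measurable_const (measurable_wnorm_inv_gram hxk)
    have hstep := lintegral_mul_mixture_le (hm _ hk1) (hξm _ hk1) (hsub _ hk1)
      (g := A.indicator (Z k))
      (a := fun ω => if Γ ≤ wnorm (gram lam (fun i => x i ω)
          (selected lam Γ (fun i => x i ω) k))⁻¹ (x (k + 1) ω) then
        (x (k + 1) ω).ofLp ⬝ᵥ ((gram lam (fun i => x i ω) (selected lam Γ (fun i => x i ω) k))⁻¹ *ᵥ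
          weightedSum (fun i => x i ω) (fun i => ξ i ω) (selected lam Γ (fun i => x i ω) k))
        else 0)
      (q := fun ω => if Γ ≤ wnorm (gram lam (fun i => x i ω)
          (selected lam Γ (fun i => x i ω) k))⁻¹ (x (k + 1) ω) then
        (x (k + 1) ω).ofLp ⬝ᵥ ((gram lam (fun i => x i ω) (selected lam Γ (fun i => x i ω) k))⁻¹ *ᵥ
          (x (k + 1) ω).ofLp) else 0)
      ((hZm k le_rfl).indicator hAm)
      (Measurable.ite hw
        (measurable_dotProduct hxv (measurable_mulVec (measurable_matrix_inv hG) hS))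
        measurable_const)
      (Measurable.ite hw
        (measurable_dotProduct hxv (measurable_mulVec (measurable_matrix_inv hG) hxv))
        measurable_const)
      (fun ω => by
        split_ifs
        · exact dotProduct_mulVec_nonneg_of_posDef (posDef_gram hlam _ _).inv _
        · exact le_rfl)
    rw [lintegral_indicator hAm'] at hstep
    refine le_trans (le_of_eq ?_) hstep
    rw [← lintegral_indicator hAm']
    refine lintegral_congr fun ω => ?_
    by_cases hω : ω ∈ A
    · rw [Set.indicator_of_mem hω, Set.indicator_of_mem hω]
      simp only [hZ]
      rw [selfNormalized_succ hlam, ENNReal.ofReal_mul]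
      unfold selfNormalized
      positivity
    · rw [Set.indicator_of_notMem hω, Set.indicator_of_notMem hω, zero_mul]
  rw [hset]
  rw [mul_comm, ← ENNReal.le_div_iff_mul_le (by simp [hδ]) (by simp), one_div,
    ← ENNReal.ofReal_inv_of_pos hpos, inv_inv] at hville
  exact hville

/-! ### Rescaling the noise and the uniform noise bound -/

section Noise

variable {Ω : Type*} {m : MeasurableSpace Ω} [mΩ : MeasurableSpace Ω] {μ : Measure Ω}
  {X : Ω → ℝ}

theorem CondSubGaussian.inv_mul {R : ℝ} (hR : R ≠ 0) (h : CondSubGaussian m μ R X) :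
    CondSubGaussian m μ 1 fun ω => R⁻¹ * X ω := by
  intro s
  obtain ⟨h1, h2⟩ := h (s * R⁻¹)
  simp_rw [mul_assoc] at h1 h2
  refine ⟨h1, ?_⟩
  filter_upwards [h2] with ω hω
  refine hω.trans (le_of_eq ?_)
  congr 1
  field_simp

/-- The nonnegative variable `exp X + exp (-X) - 2` has expectation at most 0 and vanishes only
where X = 0. -/
theorem CondSubGaussian.ae_eq_zero [IsProbabilityMeasure μ] (hm : m ≤ mΩ)
    (h : CondSubGaussian m μ 0 X) : ∀ᵐ ω ∂μ, X ω = 0 := by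
  have hint : ∀ s : ℝ, ∫ ω, Real.exp (s * X ω) ∂μ ≤ 1 := by
    intro s
    obtain ⟨-, h2⟩ := h s
    rw [← integral_condExp hm]
    calc _ ≤ ∫ _, (1 : ℝ) ∂μ := by
          refine integral_mono_ae integrable_condExp (integrable_const _) ?_
          filter_upwards [h2] with ω hω
          simpa using hω
      _ = 1 := by simp
  have hi : Integrable (fun ω => Real.exp (1 * X ω) + Real.exp (-1 * X ω)) μ :=
    (h 1).1.add (h (-1)).1
  have hnn : ∀ ω, 0 ≤ Real.exp (1 * X ω) + Real.exp (-1 * X ω) - 2 := fun ω => by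
    linarith [Real.add_one_le_exp (1 * X ω), Real.add_one_le_exp (-1 * X ω)]
  have hi2 : Integrable (fun ω => Real.exp (1 * X ω) + Real.exp (-1 * X ω) - 2) μ :=
    hi.sub (integrable_const 2)
  have h0 : ∫ ω, (Real.exp (1 * X ω) + Real.exp (-1 * X ω) - 2) ∂μ = 0 := by
    refine le_antisymm ?_ (integral_nonneg hnn)
    rw [integral_sub hi (integrable_const 2), integral_add (h 1).1 (h (-1)).1]
    have := hint 1
    have := hint (-1)
    simp only [integral_const, probReal_univ, smul_eq_mul]
    linarith
  filter_upwards [(integral_eq_zero_iff_of_nonneg hnn hi2).1 h0] with ω hω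
  by_contra hne
  have h1 := Real.add_one_lt_exp (x := 1 * X ω) (by simpa using hne)
  have h2 := Real.add_one_le_exp (-1 * X ω)
  simp only [Pi.zero_apply] at hω
  linarith

end Noise

theorem le_selfNormalized {d : ℕ} {lam Γ δ : ℝ} (hlam : 0 < lam) (hδ : 0 < δ) {x : ℕ → Vec d}
    {ξ : ℕ → ℝ} {k : ℕ}
    (h : Real.log ((gram lam x (selected lam Γ x k)).det / lam ^ d) + 2 * Real.log (1 / δ) ≤
      weightedSum x ξ (selected lam Γ x k) ⬝ᵥ ((gram lam x (selected lam Γ x k))⁻¹ *ᵥ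
        weightedSum x ξ (selected lam Γ x k))) :
    δ⁻¹ ≤ selfNormalized lam Γ x ξ k := by
  have hD : 0 < (gram lam x (selected lam Γ x k)).det / lam ^ d :=
    div_pos (posDef_gram hlam x _).det_pos (by positivity)
  unfold selfNormalized
  set D := (gram lam x (selected lam Γ x k)).det / lam ^ d
  rw [le_inv_mul_iff₀ (Real.sqrt_pos.2 hD)]
  calc Real.sqrt D * δ⁻¹ = Real.exp ((Real.log D + 2 * Real.log (1 / δ)) / 2) := by
        rw [add_div, mul_div_cancel_left₀ _ two_ne_zero, Real.exp_add,
          Real.exp_log (by positivity), one_div, ← Real.log_sqrt hD.le,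
          Real.exp_log (Real.sqrt_pos.2 hD)]
    _ ≤ _ := Real.exp_le_exp.2 (by linarith)

theorem history_le {Ω : Type*} [mΩ : MeasurableSpace Ω] {d K : ℕ} {x : ℕ → Ω → Vec d}
    {ε : ℕ → Ω → ℝ} (h : ∀ k ∈ Finset.Icc 1 K, Measurable (x k) ∧ Measurable (ε k)) {k : ℕ}
    (hk : k ∈ Finset.Icc 1 K) : history x ε k ≤ mΩ := by
  rw [Finset.mem_Icc] at hk
  refine sup_le (iSup₂_le fun i hi => ?_) (iSup₂_le fun i hi => ?_)
  · rw [Finset.mem_Icc] at hi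
    exact (h i (by rw [Finset.mem_Icc]; omega)).1.comap_le
  · rw [Finset.mem_Ico] at hi
    exact (h i (by rw [Finset.mem_Icc]; omega)).2.comap_le

theorem measurable_history_arm {Ω : Type*} {d : ℕ} (x : ℕ → Ω → Vec d) (ε : ℕ → Ω → ℝ) {k i : ℕ}
    (hi : i ∈ Finset.Icc 1 k) : Measurable[history x ε k] (x i) :=
  Measurable.of_comap_le (le_sup_of_le_left
    (le_iSup₂ (f := fun i _ => MeasurableSpace.comap (x i) inferInstance) i hi))

theorem measurable_history_noise {Ω : Type*} {d : ℕ} (x : ℕ → Ω → Vec d) (ε : ℕ → Ω → ℝ)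
    {k i : ℕ} (hi : i ∈ Finset.Ico 1 k) : Measurable[history x ε k] (ε i) :=
  Measurable.of_comap_le (le_sup_of_le_right
    (le_iSup₂ (f := fun i _ => MeasurableSpace.comap (ε i) inferInstance) i hi))

/-- The self-normalized concentration inequality, uniformly over the rounds. -/
theorem measure_exists_lt_quadForm_le {Ω : Type*} [MeasurableSpace Ω] {μ : Measure Ω}
    [IsProbabilityMeasure μ] {d K : ℕ} {lam Γ δ R : ℝ} (hlam : 0 < lam) (hδ : 0 < δ)
    {x : ℕ → Ω → Vec d} {ε : ℕ → Ω → ℝ}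
    (hmeas : ∀ k ∈ Finset.Icc 1 K, Measurable (x k) ∧ Measurable (ε k))
    (hsub : ∀ k ∈ Finset.Icc 1 K, CondSubGaussian (history x ε k) μ R (ε k)) :
    μ {ω | ∃ k ≤ K, R ^ 2 * (Real.log ((gram lam (fun i => x i ω)
          (selected lam Γ (fun i => x i ω) k)).det / lam ^ d) + 2 * Real.log (1 / δ)) <
        weightedSum (fun i => x i ω) (fun i => ε i ω) (selected lam Γ (fun i => x i ω) k) ⬝ᵥ
          ((gram lam (fun i => x i ω) (selected lam Γ (fun i => x i ω) k))⁻¹ *ᵥ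
            weightedSum (fun i => x i ω) (fun i => ε i ω)
              (selected lam Γ (fun i => x i ω) k))} ≤ ENNReal.ofReal δ := by
  -- For R = 0 the noise cannot be divided by R; there it is almost surely zero and the strict
  -- inequality fails.
  rcases eq_or_ne R 0 with rfl | hR
  · have hz : ∀ᵐ ω ∂μ, ∀ k ∈ Finset.Icc 1 K, ε k ω = 0 := by
      rw [Finset.eventually_all]
      exact fun k hk => (hsub k hk).ae_eq_zero (history_le hmeas hk)
    refine (le_of_eq (measure_mono_null ?_ (ae_iff.1 hz))).trans zero_le
    rintro ω ⟨k, hk, h⟩ h0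
    have : weightedSum (fun i => x i ω) (fun i => ε i ω) (selected lam Γ (fun i => x i ω) k) =
        0 := Finset.sum_eq_zero fun i hi => by
      simp [h0 i (Finset.Icc_subset_Icc_right hk (selected_subset _ _ _ _ hi))]
    rw [this] at h
    simp at h
  · refine (measure_mono ?_).trans (measure_exists_le_selfNormalized (Γ := Γ) hlam hδ
      (ξ := fun k ω => R⁻¹ * ε k ω) (m := history x ε)
      (fun k hk => history_le hmeas hk) (fun k _ i hi => measurable_history_arm x ε hi)
      (fun k _ i hi => (measurable_history_noise x ε hi).const_mul _)
      (fun k hk => (hmeas k hk).2.const_mul _)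
      (fun k hk => (hsub k hk).inv_mul hR))
    rintro ω ⟨k, hk, h⟩
    refine ⟨k, hk, le_selfNormalized hlam hδ ?_⟩
    have hS : weightedSum (fun i => x i ω) (fun i => R⁻¹ * ε i ω)
        (selected lam Γ (fun i => x i ω) k) = R⁻¹ • weightedSum (fun i => x i ω)
          (fun i => ε i ω) (selected lam Γ (fun i => x i ω) k) := by
      simp_rw [weightedSum, Finset.smul_sum, mul_smul]
    rw [hS, Matrix.mulVec_smul, smul_dotProduct, dotProduct_smul, smul_eq_mul, smul_eq_mul,
      ← mul_assoc, ← mul_inv, ← sq, le_inv_mul_iff₀ (by positivity)]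
    exact h.le

/-- Resolves the implicit bound on the sample size, with y = nΓ²/d and M = LB/Γ. The tangent to the
logarithm at 8 makes the coefficient of y on the right only 1/4, so y can be absorbed. -/
theorem le_log_three_mul {y M : ℝ} (hy : 0 ≤ y) (hM : 1 ≤ M)
    (h : y ≤ 2 * Real.log (1 + y * M ^ 2)) : y ≤ 16 * Real.log (3 * M) := by
  have hM0 : 0 < M := by linarith
  have h1 : Real.log (1 + y * M ^ 2) ≤ 2 * Real.log M + Real.log (1 + y) := by
    have : 1 + y * M ^ 2 ≤ M ^ 2 * (1 + y) := by nlinarith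
    refine (Real.log_le_log (by positivity) this).trans (le_of_eq ?_)
    rw [Real.log_mul (by positivity) (by positivity), Real.log_pow]
    norm_num
  have h2 : Real.log (1 + y) ≤ (1 + y) / 8 - 1 + 3 * Real.log 2 := by
    have := Real.log_le_sub_one_of_pos (by positivity : 0 < (1 + y) / 8)
    rw [Real.log_div (by positivity) (by norm_num), show (8 : ℝ) = 2 ^ 3 by norm_num,
      Real.log_pow] at this
    norm_num at this ⊢
    linarith
  have h3 : 1 ≤ Real.log 3 :=
    ((Real.lt_log_iff_exp_lt (by norm_num)).2 Real.exp_one_lt_three).le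
  have h4 := Real.log_two_lt_d9
  rw [Real.log_mul (by norm_num) hM0.ne']
  have := Real.log_nonneg hM
  linarith

/-! ### Sample size and regret on a good realization -/

section Deterministic

variable {d K : ℕ} {lam Γ β ζ L Δ : ℝ} {x : ℕ → Vec d} {y : ℕ → ℝ} {D : ℕ → Set (Vec d)}
  {r : Vec d → ℝ} {θ : Vec d}

theorem card_selected_mul_sq_le (hlam : 0 < lam) (hd : 1 ≤ d) (hΓ : 0 ≤ Γ) (hΓ1 : Γ ≤ 1)
    (hx : ∀ i ∈ selected lam Γ x K, ‖x i‖ ≤ L) :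
    (selected lam Γ x K).card * Γ ^ 2 ≤
      2 * d * Real.log (1 + (selected lam Γ x K).card * L ^ 2 / (d * lam)) := by
  refine le_trans ?_ (sum_min_one_sq_wnorm_le hlam hd hx)
  rw [← nsmul_eq_mul]
  refine Finset.card_nsmul_le_sum _ _ _ fun i hi => le_min ?_ ?_
  · exact pow_le_one₀ hΓ hΓ1
  · exact pow_le_pow_left₀ hΓ (mem_selected.1 hi).2 2

/-- The number of selected rounds is bounded independently of the horizon. -/
theorem card_selected_le {B : ℝ} (hB : 1 ≤ B) (hL : 1 ≤ L) (hd : 1 ≤ d) (hΓ : 0 < Γ)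
    (hΓ1 : Γ ≤ 1) (hx : ∀ i ∈ selected (B⁻¹ ^ 2) Γ x K, ‖x i‖ ≤ L) :
    ((selected (B⁻¹ ^ 2) Γ x K).card : ℝ) ≤ 16 * d * Γ⁻¹ ^ 2 * Real.log (3 * L * B * Γ⁻¹) := by
  have hB0 : 0 < B := by linarith
  have hd' : (0 : ℝ) < d := by exact_mod_cast hd
  have h := card_selected_mul_sq_le (by positivity) hd hΓ.le hΓ1 hx
  set n : ℝ := ((selected (B⁻¹ ^ 2) Γ x K).card : ℝ) with hn
  have hn0 : 0 ≤ n := Nat.cast_nonneg _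
  have hM : 1 ≤ L * B * Γ⁻¹ := by
    have := (one_le_inv₀ hΓ).2 hΓ1
    nlinarith [mul_le_mul hL hB (by norm_num) (by linarith)]
  have key := le_log_three_mul (y := n * Γ ^ 2 / d) (by positivity) hM (by
    rw [div_le_iff₀ hd']
    refine h.trans (le_of_eq ?_)
    have : n * Γ ^ 2 / d * (L * B * Γ⁻¹) ^ 2 = n * L ^ 2 / (d * B⁻¹ ^ 2) := by field_simp
    rw [this]
    ring)
  rw [div_le_iff₀ hd', ← mul_assoc, ← mul_assoc] at key
  calc n = n * Γ ^ 2 * Γ⁻¹ ^ 2 := by field_simp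
    _ ≤ (16 * Real.log (3 * L * B * Γ⁻¹) * d) * Γ⁻¹ ^ 2 := by gcongr
    _ = _ := by ring

/-- Optimism: any arm's value is below its index up to ζ, the chosen arm has the largest index, and
its index exceeds its value by at most twice its bonus term plus ζ. -/
theorem optReward_sub_le (hrun : IsRun lam Γ β K D x y)
    (hD : ∀ k ∈ Finset.Icc 1 K, ∀ v ∈ D k, |r v - inner ℝ v θ| ≤ ζ)
    (hconf : ∀ k ∈ Finset.Icc 1 K, ∀ v,
      |inner ℝ v (estimate lam Γ x y k) - inner ℝ v θ| ≤ β * wnorm (design lam Γ x k)⁻¹ v)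
    {k : ℕ} (hk : k ∈ Finset.Icc 1 K) :
    optReward r (D k) - r (x k) ≤ 2 * β * wnorm (design lam Γ x k)⁻¹ (x k) + 2 * ζ := by
  obtain ⟨hxk, hmax⟩ := hrun k hk
  rw [sub_le_iff_le_add]
  refine csSup_le ⟨r (x k), x k, hxk, rfl⟩ ?_
  rintro _ ⟨v, hv, rfl⟩
  have h1 := abs_le.1 (hD k hk v hv)
  have h2 := abs_le.1 (hD k hk _ hxk)
  have h3 := abs_le.1 (hconf k hk v)
  have h4 := abs_le.1 (hconf k hk (x k))
  have h5 := hmax v hv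
  unfold ucb at h5
  linarith [h1.2, h2.1, h3.1, h4.2]

/-- The regret of a run on which the confidence bounds hold. -/
theorem regret_le_of_forall_abs_inner_sub_le (hlam : 0 < lam) (hd : 1 ≤ d) (hβ : 0 ≤ β)
    (hζΓ : ζ ≤ Γ) (hrun : IsRun lam Γ β K D x y)
    (hD : ∀ k ∈ Finset.Icc 1 K, ∀ v ∈ D k,
      ‖v‖ ≤ L ∧ 0 ≤ r v ∧ r v ≤ 1 ∧ |r v - inner ℝ v θ| ≤ ζ)
    (hgap : ∀ k ∈ Finset.Icc 1 K, ∀ v ∈ D k, 0 < optReward r (D k) - r v →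
      Δ ≤ optReward r (D k) - r v)
    (hΔ : 2 * β * Γ + 2 * ζ < Δ)
    (hconf : ∀ k ∈ Finset.Icc 1 K, ∀ v,
      |inner ℝ v (estimate lam Γ x y k) - inner ℝ v θ| ≤ β * wnorm (design lam Γ x k)⁻¹ v) :
    regret r K D x ≤ (2 * β + 2) * Real.sqrt ((selected lam Γ x K).card *
      (2 * d * Real.log (1 + (selected lam Γ x K).card * L ^ 2 / (d * lam)))) := by
  have hround : ∀ k ∈ Finset.Icc 1 K, optReward r (D k) - r (x k) ≤
      2 * β * wnorm (design lam Γ x k)⁻¹ (x k) + 2 * ζ := fun k hk =>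
    optReward_sub_le hrun (fun k hk v hv => (hD k hk v hv).2.2.2) hconf hk
  have hsub := selected_subset lam Γ x K
  -- A positive gap would be at least Δ, but with bonus below Γ the round's regret is less than Δ.
  have hzero : ∀ k ∈ Finset.Icc 1 K, k ∉ selected lam Γ x K →
      optReward r (D k) - r (x k) ≤ 0 := by
    intro k hk hns
    by_contra! hpos
    have hlt : wnorm (design lam Γ x k)⁻¹ (x k) < Γ := by
      by_contra! h
      exact hns (mem_selected.2 ⟨hk, h⟩)
    have h1 := hgap k hk (x k) (hrun k hk).1 hpos
    have h2 := hround k hk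
    nlinarith
  -- If the bonus is at least 1, the trivial bound 1 suffices. Otherwise ζ ≤ Γ ≤ bonus turns the
  -- additive 2ζ into a multiple of the bonus.
  have hsel : ∀ k ∈ selected lam Γ x K, optReward r (D k) - r (x k) ≤
      (2 * β + 2) * min 1 (wnorm (design lam Γ x k)⁻¹ (x k)) := by
    intro k hk
    obtain ⟨hk1, hw⟩ := mem_selected.1 hk
    rcases le_total 1 (wnorm (design lam Γ x k)⁻¹ (x k)) with h | h
    · rw [min_eq_left h]
      have h1 : optReward r (D k) ≤ 1 := by
        refine csSup_le ⟨r (x k), x k, (hrun k hk1).1, rfl⟩ ?_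
        rintro _ ⟨v, hv, rfl⟩
        exact (hD k hk1 v hv).2.2.1
      have h2 := (hD k hk1 _ (hrun k hk1).1).2.1
      linarith
    · rw [min_eq_right h]
      have := hround k hk1
      linarith
  have hxL : ∀ i ∈ selected lam Γ x K, ‖x i‖ ≤ L := fun i hi =>
    (hD i (hsub hi) _ (hrun i (hsub hi)).1).1
  calc regret r K D x
      ≤ ∑ k ∈ selected lam Γ x K, (optReward r (D k) - r (x k)) := by
        rw [regret, ← Finset.sum_sdiff hsub]
        refine add_le_of_nonpos_left (Finset.sum_nonpos fun k hk => ?_)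
        rw [Finset.mem_sdiff] at hk
        exact hzero k hk.1 hk.2
    _ ≤ ∑ k ∈ selected lam Γ x K, (2 * β + 2) * min 1 (wnorm (design lam Γ x k)⁻¹ (x k)) :=
        Finset.sum_le_sum hsel
    _ = (2 * β + 2) * ∑ k ∈ selected lam Γ x K, min 1 (wnorm (design lam Γ x k)⁻¹ (x k)) :=
        (Finset.mul_sum _ _ _).symm
    _ ≤ _ := by
        refine mul_le_mul_of_nonneg_left (Real.le_sqrt_of_sq_le ?_) (by linarith)
        refine sq_sum_le_card_mul_sum_sq.trans ?_
        refine mul_le_mul_of_nonneg_left ?_ (Nat.cast_nonneg _)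
        refine le_trans (Finset.sum_le_sum fun k _ => ?_) (sum_min_one_sq_wnorm_le hlam hd hxL)
        have h0 := wnorm_nonneg (design lam Γ x k)⁻¹ (x k)
        refine le_min ?_ ?_
        · exact pow_le_one₀ (le_min zero_le_one h0) (min_le_left _ _)
        · exact pow_le_pow_left₀ (le_min zero_le_one h0) (min_le_right _ _) 2

end Deterministic

/-! ### Inequalities between the parameters -/

section Parameters

variable {d : ℕ} {L B R Δ δ : ℝ}

/-- The argument is at least 72 > e⁴. The 4 is the source of the later lower bounds ι₁ ≥ 24·4, ι₂ ≥
4 and β ≥ 1 + 4·2. -/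
theorem four_le_log_gap (hd : 1 ≤ d) (hL : 1 ≤ L) (hB : 1 ≤ B) (hR : 0 ≤ R) (hΔ : 0 < Δ)
    (hΔ1 : Δ ≤ 1) : 4 ≤ Real.log ((72 + 54 * R) * L * B * Real.sqrt d * Δ⁻¹) := by
  have hd' : (1 : ℝ) ≤ d := by exact_mod_cast hd
  have hsd : 1 ≤ Real.sqrt d := Real.one_le_sqrt.2 hd'
  have hi : 1 ≤ Δ⁻¹ := (one_le_inv₀ hΔ).2 hΔ1
  have h72 : (72 : ℝ) ≤ (72 + 54 * R) * L * B * Real.sqrt d * Δ⁻¹ :=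
    calc (72 : ℝ) = 72 * 1 * 1 * 1 * 1 := by norm_num
      _ ≤ _ := by gcongr; linarith
  refine (Real.le_log_iff_exp_le (by linarith)).2 (le_trans ?_ h72)
  calc Real.exp 4 = Real.exp 1 ^ 4 := by rw [← Real.exp_nat_mul]; norm_num
    _ ≤ 2.72 ^ 4 := by
        gcongr
        linarith [Real.exp_one_lt_d9]
    _ ≤ 72 := by norm_num

theorem le_iota1 (hd : 1 ≤ d) (hL : 1 ≤ L) (hB : 1 ≤ B) (hR : 0 ≤ R) (hΔ : 0 < Δ) (hΔ1 : Δ ≤ 1) :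
    96 ≤ iota1 d L B R Δ δ := by
  have h := four_le_log_gap hd hL hB hR hΔ hΔ1
  unfold iota1
  nlinarith [Real.sqrt_nonneg (8 * R ^ 2 * Real.log (1 / δ))]

theorem threshold_pos (hd : 1 ≤ d) (hL : 1 ≤ L) (hB : 1 ≤ B) (hR : 0 ≤ R) (hΔ : 0 < Δ)
    (hΔ1 : Δ ≤ 1) : 0 < threshold d L B R Δ δ := by
  have h := le_iota1 (δ := δ) hd hL hB hR hΔ hΔ1
  have hd' : (0 : ℝ) < d := by exact_mod_cast hd
  unfold threshold
  have : 0 < iota1 d L B R Δ δ := by linarith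
  positivity

theorem threshold_le_one (hd : 1 ≤ d) (hL : 1 ≤ L) (hB : 1 ≤ B) (hR : 0 ≤ R) (hΔ : 0 < Δ)
    (hΔ1 : Δ ≤ 1) : threshold d L B R Δ δ ≤ 1 := by
  have h := le_iota1 (δ := δ) hd hL hB hR hΔ hΔ1
  have hd' : (1 : ℝ) ≤ d := by exact_mod_cast hd
  have hsd : 1 ≤ Real.sqrt d := Real.one_le_sqrt.2 hd'
  unfold threshold
  rw [div_le_one (by positivity)]
  nlinarith

theorem inv_threshold : (threshold d L B R Δ δ)⁻¹ = 2 * Real.sqrt d * iota1 d L B R Δ δ / Δ := by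
  rw [threshold, inv_div]

/-- Since 72 + 54R = 3(24 + 18R), the logarithm X inside ι₁ splits off from ι₂. The remainder is a
logarithm of ι₁ itself, which `log t ≤ t / 2` later makes linear. -/
theorem iota2_eq (hd : 1 ≤ d) (hL : 1 ≤ L) (hB : 1 ≤ B) (hR : 0 ≤ R) (hΔ : 0 < Δ) (hΔ1 : Δ ≤ 1) :
    iota2 d L B R Δ δ = Real.log ((72 + 54 * R) * L * B * Real.sqrt d * Δ⁻¹) +
      Real.log (2 * (iota1 d L B R Δ δ / (24 + 18 * R))) := by
  have h := le_iota1 (δ := δ) hd hL hB hR hΔ hΔ1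
  have hd' : (0 : ℝ) < d := by exact_mod_cast hd
  have h1 : 0 < iota1 d L B R Δ δ := by linarith
  have hL0 : 0 < L := by linarith
  have hB0 : 0 < B := by linarith
  rw [iota2, inv_threshold, ← Real.log_mul (by positivity) (by positivity)]
  congr 1
  field_simp
  ring

theorem iota1_div (hR : 0 ≤ R) : iota1 d L B R Δ δ / (24 + 18 * R) =
    Real.log ((72 + 54 * R) * L * B * Real.sqrt d * Δ⁻¹) +
      Real.sqrt (8 * R ^ 2 * Real.log (1 / δ)) / (24 + 18 * R) := by
  have : 24 + 18 * R ≠ 0 := by positivity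
  rw [iota1]
  field_simp

theorem four_le_iota2 (hd : 1 ≤ d) (hL : 1 ≤ L) (hB : 1 ≤ B) (hR : 0 ≤ R) (hΔ : 0 < Δ)
    (hΔ1 : Δ ≤ 1) : 4 ≤ iota2 d L B R Δ δ := by
  have h := four_le_log_gap hd hL hB hR hΔ hΔ1
  rw [iota2_eq hd hL hB hR hΔ hΔ1, iota1_div hR]
  have h2 : 0 ≤ Real.sqrt (8 * R ^ 2 * Real.log (1 / δ)) / (24 + 18 * R) := by positivity
  have := Real.log_nonneg (x := 2 * (Real.log ((72 + 54 * R) * L * B * Real.sqrt d * Δ⁻¹) +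
      Real.sqrt (8 * R ^ 2 * Real.log (1 / δ)) / (24 + 18 * R))) (by linarith)
  linarith

theorem log_le_half {t : ℝ} (ht : 0 < t) : Real.log t ≤ t / 2 := by
  have h := Real.log_le_sub_one_of_pos (half_pos ht)
  rw [Real.log_div ht.ne' two_ne_zero] at h
  linarith [Real.log_two_lt_d9]

theorem iota2_le (hd : 1 ≤ d) (hL : 1 ≤ L) (hB : 1 ≤ B) (hR : 0 ≤ R) (hΔ : 0 < Δ) (hΔ1 : Δ ≤ 1) :
    iota2 d L B R Δ δ ≤ 2 * Real.log ((72 + 54 * R) * L * B * Real.sqrt d * Δ⁻¹) +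
      Real.sqrt (8 * R ^ 2 * Real.log (1 / δ)) / (24 + 18 * R) := by
  have h := four_le_log_gap hd hL hB hR hΔ hΔ1
  have h2 : 0 ≤ Real.sqrt (8 * R ^ 2 * Real.log (1 / δ)) / (24 + 18 * R) := by positivity
  rw [iota2_eq hd hL hB hR hΔ hΔ1, iota1_div hR]
  have := log_le_half (t := 2 * (Real.log ((72 + 54 * R) * L * B * Real.sqrt d * Δ⁻¹) +
      Real.sqrt (8 * R ^ 2 * Real.log (1 / δ)) / (24 + 18 * R))) (by linarith)
  linarith

theorem exp_iota2 (hd : 1 ≤ d) (hL : 1 ≤ L) (hB : 1 ≤ B) (hR : 0 ≤ R) (hΔ : 0 < Δ) (hΔ1 : Δ ≤ 1) :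
    Real.exp (iota2 d L B R Δ δ) = 3 * L * B * (threshold d L B R Δ δ)⁻¹ := by
  have := threshold_pos (δ := δ) hd hL hB hR hΔ hΔ1
  rw [iota2, Real.exp_log]
  positivity

/-- With t = ι₂ one has exp t = 3LB/Γ, so the argument is 1 + (16/9) t exp(2t), at most exp(3t)
because t ≥ 4. -/
theorem log_one_add_le_three_mul_iota2 (hd : 1 ≤ d) (hL : 1 ≤ L) (hB : 1 ≤ B) (hR : 0 ≤ R)
    (hΔ : 0 < Δ) (hΔ1 : Δ ≤ 1) :
    Real.log (1 + 16 * L ^ 2 * B ^ 2 * ((threshold d L B R Δ δ)⁻¹) ^ 2 * iota2 d L B R Δ δ) ≤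
      3 * iota2 d L B R Δ δ := by
  have hι := four_le_iota2 (δ := δ) hd hL hB hR hΔ hΔ1
  have hexp := exp_iota2 (δ := δ) hd hL hB hR hΔ hΔ1
  set t := iota2 d L B R Δ δ
  have h1 : 16 * L ^ 2 * B ^ 2 * ((threshold d L B R Δ δ)⁻¹) ^ 2 * t =
      16 / 9 * Real.exp t ^ 2 * t := by rw [hexp]; ring
  have hq := Real.quadratic_le_exp_of_nonneg (by linarith : 0 ≤ t)
  have he : 1 ≤ Real.exp t := Real.one_le_exp (by linarith)
  rw [h1]
  refine (Real.log_le_iff_le_exp (by positivity)).2 ?_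
  rw [show Real.exp (3 * t) = Real.exp t ^ 2 * Real.exp t by
    rw [← pow_succ, ← Real.exp_nat_mul]; norm_num]
  have h2 : 1 + 16 / 9 * t ≤ Real.exp t := by nlinarith
  nlinarith [mul_le_mul_of_nonneg_left h2 (sq_nonneg (Real.exp t))]

theorem iota3_eq (hd : 1 ≤ d) (hL : 1 ≤ L) (hB : 1 ≤ B) (hR : 0 ≤ R) (hΔ : 0 < Δ) (hΔ1 : Δ ≤ 1)
    (hδ : 0 < δ) : iota3 d L B R Δ δ =
      Real.log (1 + 16 * L ^ 2 * B ^ 2 * ((threshold d L B R Δ δ)⁻¹) ^ 2 * iota2 d L B R Δ δ) +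
        Real.log (1 / δ) := by
  have hι := four_le_iota2 (δ := δ) hd hL hB hR hΔ hΔ1
  have : 0 < iota2 d L B R Δ δ := by linarith
  rw [iota3, div_eq_mul_one_div, Real.log_mul (by positivity) (by positivity)]

/-- This is where the constants 24 and 18 are used. Multiplied by √d it gives β + 1 < √d ι₁. -/
theorem two_add_sqrt_lt_iota1 (hd : 1 ≤ d) (hL : 1 ≤ L) (hB : 1 ≤ B) (hR : 0 ≤ R) (hΔ : 0 < Δ)
    (hΔ1 : Δ ≤ 1) (hδ : 0 < δ) (hδ1 : δ < 1) :
    2 + 4 * Real.sqrt (iota2 d L B R Δ δ) + R * Real.sqrt (2 * iota3 d L B R Δ δ) <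
      iota1 d L B R Δ δ := by
  have hX := four_le_log_gap hd hL hB hR hΔ hΔ1
  have hι := four_le_iota2 (δ := δ) hd hL hB hR hΔ hΔ1
  have hι2 := iota2_le (δ := δ) hd hL hB hR hΔ hΔ1
  have hA := log_one_add_le_three_mul_iota2 (δ := δ) hd hL hB hR hΔ hΔ1
  have hℓ : 0 < Real.log (1 / δ) := Real.log_pos ((one_lt_div hδ).2 hδ1)
  have hs : R * Real.sqrt (2 * Real.log (1 / δ)) =
      Real.sqrt (8 * R ^ 2 * Real.log (1 / δ)) / 2 := by
    rw [show 8 * R ^ 2 * Real.log (1 / δ) = (2 * R) ^ 2 * (2 * Real.log (1 / δ)) by ring,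
      Real.sqrt_mul (sq_nonneg _), Real.sqrt_sq (by positivity)]
    ring
  have h3 : Real.sqrt (2 * iota3 d L B R Δ δ) ≤
      5 / 2 * Real.sqrt (iota2 d L B R Δ δ) + Real.sqrt (2 * Real.log (1 / δ)) := by
    rw [iota3_eq hd hL hB hR hΔ hΔ1 hδ, mul_add]
    refine Real.sqrt_le_iff.2 ⟨by positivity, ?_⟩
    have h1 := Real.sq_sqrt (by linarith : 0 ≤ iota2 d L B R Δ δ)
    have h2 := Real.sq_sqrt (by linarith : 0 ≤ 2 * Real.log (1 / δ))
    have h3 := mul_nonneg (Real.sqrt_nonneg (iota2 d L B R Δ δ))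
      (Real.sqrt_nonneg (2 * Real.log (1 / δ)))
    rw [add_sq, mul_pow, h1, h2]
    linarith
  have hI : Real.sqrt (iota2 d L B R Δ δ) ≤ iota2 d L B R Δ δ / 4 + 1 := by
    have := Real.sq_sqrt (by linarith : 0 ≤ iota2 d L B R Δ δ)
    nlinarith [sq_nonneg (Real.sqrt (iota2 d L B R Δ δ) - 2)]
  have h4 := mul_le_mul_of_nonneg_left h3 hR
  rw [mul_add, hs] at h4
  unfold iota1
  set X := Real.log ((72 + 54 * R) * L * B * Real.sqrt d * Δ⁻¹)
  set s := Real.sqrt (8 * R ^ 2 * Real.log (1 / δ))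
  have hs0 : 0 ≤ s := Real.sqrt_nonneg _
  have h5 : Real.sqrt (iota2 d L B R Δ δ) ≤ X / 2 + s / (24 + 18 * R) / 4 + 1 := by linarith
  -- Here 5/2 dominates √6, from ι₃ ≤ 3ι₂ + log(1/δ), and 4 + 5R/2 ≤ (24 + 18R)/6. Only a twelfth of
  -- the main term of ι₁ is consumed.
  have h6 : (4 + 5 / 2 * R) * Real.sqrt (iota2 d L B R Δ δ) ≤
      (24 + 18 * R) / 6 * (X / 2 + s / (24 + 18 * R) / 4 + 1) := by
    refine mul_le_mul (by linarith) h5 (Real.sqrt_nonneg _) (by positivity)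
  have h7 : (24 + 18 * R) / 6 * (X / 2 + s / (24 + 18 * R) / 4 + 1) =
      (24 + 18 * R) * X / 12 + s / 24 + (24 + 18 * R) / 6 := by
    have : 24 + 18 * R ≠ 0 := by positivity
    field_simp
    ring
  rw [h7] at h6
  nlinarith [mul_nonneg hR (by linarith : 0 ≤ X)]

theorem nine_le_radius (hd : 1 ≤ d) (hL : 1 ≤ L) (hB : 1 ≤ B) (hR : 0 ≤ R) (hΔ : 0 < Δ)
    (hΔ1 : Δ ≤ 1) : 9 ≤ radius d L B R Δ δ := by
  have hι := four_le_iota2 (δ := δ) hd hL hB hR hΔ hΔ1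
  have hd' : (1 : ℝ) ≤ d := by exact_mod_cast hd
  have h1 : 2 ≤ Real.sqrt (d * iota2 d L B R Δ δ) := Real.le_sqrt_of_sq_le (by nlinarith)
  have h2 : 0 ≤ R * Real.sqrt (2 * d * iota3 d L B R Δ δ) := by positivity
  unfold radius
  linarith

theorem radius_add_one_lt (hd : 1 ≤ d) (hL : 1 ≤ L) (hB : 1 ≤ B) (hR : 0 ≤ R) (hΔ : 0 < Δ)
    (hΔ1 : Δ ≤ 1) (hδ : 0 < δ) (hδ1 : δ < 1) :
    radius d L B R Δ δ + 1 < Real.sqrt d * iota1 d L B R Δ δ := by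
  have h := two_add_sqrt_lt_iota1 hd hL hB hR hΔ hΔ1 hδ hδ1
  have hd' : (1 : ℝ) ≤ d := by exact_mod_cast hd
  have hsd : 1 ≤ Real.sqrt d := Real.one_le_sqrt.2 hd'
  have h1 := mul_lt_mul_of_pos_left h (by linarith : 0 < Real.sqrt d)
  rw [radius, Real.sqrt_mul (by linarith),
    show 2 * (d : ℝ) * iota3 d L B R Δ δ = d * (2 * iota3 d L B R Δ δ) by ring,
    Real.sqrt_mul (by linarith)]
  nlinarith

theorem two_mul_radius_mul_threshold_lt {ζ : ℝ} (hd : 1 ≤ d) (hL : 1 ≤ L) (hB : 1 ≤ B)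
    (hR : 0 ≤ R) (hΔ : 0 < Δ) (hΔ1 : Δ ≤ 1) (hδ : 0 < δ) (hδ1 : δ < 1)
    (hζ : ζ ≤ threshold d L B R Δ δ) :
    2 * radius d L B R Δ δ * threshold d L B R Δ δ + 2 * ζ < Δ := by
  have h := radius_add_one_lt hd hL hB hR hΔ hΔ1 hδ hδ1
  have hΓ := threshold_pos (δ := δ) hd hL hB hR hΔ hΔ1
  have hι := le_iota1 (δ := δ) hd hL hB hR hΔ hΔ1
  have hd' : (0 : ℝ) < d := by exact_mod_cast hd
  have h1 : Real.sqrt d * iota1 d L B R Δ δ * (2 * threshold d L B R Δ δ) = Δ := by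
    have : 0 < iota1 d L B R Δ δ := by linarith
    rw [threshold]
    field_simp
  have := mul_lt_mul_of_pos_right h (by positivity : 0 < 2 * threshold d L B R Δ δ)
  rw [h1] at this
  linarith

theorem le_threshold_of_le {ζ : ℝ} (hd : 1 ≤ d) (hL : 1 ≤ L) (hB : 1 ≤ B) (hR : 0 ≤ R)
    (hΔ : 0 < Δ) (hΔ1 : Δ ≤ 1) (h : 2 * Real.sqrt d * ζ * iota1 d L B R Δ δ ≤ Δ) :
    ζ ≤ threshold d L B R Δ δ := by
  have hι := le_iota1 (δ := δ) hd hL hB hR hΔ hΔ1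
  have : 0 < iota1 d L B R Δ δ := by linarith
  have hd' : (0 : ℝ) < d := by exact_mod_cast hd
  rw [threshold, le_div_iff₀ (by positivity)]
  linarith

theorem sampleBound_nonneg (hd : 1 ≤ d) (hL : 1 ≤ L) (hB : 1 ≤ B) (hR : 0 ≤ R) (hΔ : 0 < Δ)
    (hΔ1 : Δ ≤ 1) : 0 ≤ sampleBound d L B R Δ δ := by
  have hι := four_le_iota2 (δ := δ) hd hL hB hR hΔ hΔ1
  have : 0 < iota2 d L B R Δ δ := by linarith
  unfold sampleBound
  positivity

/-- Substituting Γ gives N = 64 d² (ι₁/Δ)² ι₂, so the prefactor ι₁/Δ can be moved under the root in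
exchange for N. -/
theorem regretBound_eq (hd : 1 ≤ d) (hL : 1 ≤ L) (hB : 1 ≤ B) (hR : 0 ≤ R) (hΔ : 0 < Δ)
    (hΔ1 : Δ ≤ 1) (c : ℝ) : regretBound c d L B R Δ δ =
      4 * radius d L B R Δ δ * Real.sqrt (sampleBound d L B R Δ δ *
        (2 * d * Real.log (1 + c * sampleBound d L B R Δ δ))) := by
  have hι := le_iota1 (δ := δ) hd hL hB hR hΔ hΔ1
  have h0 : 0 ≤ iota1 d L B R Δ δ := by linarith
  have h1 : sampleBound d L B R Δ δ * (2 * d * Real.log (1 + c * sampleBound d L B R Δ δ)) =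
      (8 * iota1 d L B R Δ δ / Δ) ^ 2 * (2 * d ^ 3 * iota2 d L B R Δ δ *
        Real.log (1 + c * sampleBound d L B R Δ δ)) := by
    have : sampleBound d L B R Δ δ =
        64 * d ^ 2 * (iota1 d L B R Δ δ / Δ) ^ 2 * iota2 d L B R Δ δ := by
      rw [sampleBound, inv_threshold, mul_div_assoc, mul_pow, mul_pow,
        Real.sq_sqrt (Nat.cast_nonneg _)]
      ring
    nth_rewrite 1 [this]
    ring
  rw [h1, Real.sqrt_mul (sq_nonneg _), Real.sqrt_sq (by positivity), regretBound]
  ring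

end Parameters

/-! ### Validity of the radius and the regret for the chosen parameters -/

section Confidence

variable {d K : ℕ} {L B R ζ Δ δ : ℝ} {x : ℕ → Vec d} {ε : ℕ → ℝ} {D : ℕ → Set (Vec d)}
  {r : Vec d → ℝ} {θ : Vec d}

theorem abs_inner_estimate_sub_le (hd : 1 ≤ d) (hL : 1 ≤ L) (hB : 1 ≤ B) (hR : 0 ≤ R)
    (hΔ : 0 < Δ) (hΔ1 : Δ ≤ 1) (hδ : 0 < δ) (hδ1 : δ < 1) (hθ : ‖θ‖ ≤ B) (hζ : 0 ≤ ζ)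
    (hζΓ : ζ ≤ threshold d L B R Δ δ)
    (hx : ∀ i ∈ Finset.Icc 1 K, ‖x i‖ ≤ L ∧ |r (x i) - inner ℝ (x i) θ| ≤ ζ) {k : ℕ} (hk : k ≤ K)
    (hnoise : weightedSum x ε (selected (B⁻¹ ^ 2) (threshold d L B R Δ δ) x k) ⬝ᵥ
          ((gram (B⁻¹ ^ 2) x (selected (B⁻¹ ^ 2) (threshold d L B R Δ δ) x k))⁻¹ *ᵥ
            weightedSum x ε (selected (B⁻¹ ^ 2) (threshold d L B R Δ δ) x k)) ≤
      R ^ 2 * (Real.log ((gram (B⁻¹ ^ 2) x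
          (selected (B⁻¹ ^ 2) (threshold d L B R Δ δ) x k)).det / (B⁻¹ ^ 2) ^ d) +
        2 * Real.log (1 / δ))) (v : Vec d) :
    |inner ℝ v (estimate (B⁻¹ ^ 2) (threshold d L B R Δ δ) x (fun i => r (x i) + ε i) (k + 1)) -
        inner ℝ v θ| ≤
      radius d L B R Δ δ *
        wnorm (design (B⁻¹ ^ 2) (threshold d L B R Δ δ) x (k + 1))⁻¹ v := by
  have hΓ := threshold_pos (δ := δ) hd hL hB hR hΔ hΔ1
  have hΓ1 := threshold_le_one (δ := δ) hd hL hB hR hΔ hΔ1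
  have hι := four_le_iota2 (δ := δ) hd hL hB hR hΔ hΔ1
  have hι3 := iota3_eq hd hL hB hR hΔ hΔ1 hδ
  have hι2 : iota2 d L B R Δ δ = Real.log (3 * L * B * (threshold d L B R Δ δ)⁻¹) := rfl
  have hrad : radius d L B R Δ δ = 1 + 4 * Real.sqrt (d * iota2 d L B R Δ δ) +
    R * Real.sqrt (2 * d * iota3 d L B R Δ δ) := rfl
  set Γ := threshold d L B R Δ δ
  have hB0 : 0 < B := by linarith
  have hlam : 0 < B⁻¹ ^ 2 := by positivity
  have hd' : (1 : ℝ) ≤ d := by exact_mod_cast hd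
  have hℓ : 0 < Real.log (1 / δ) := Real.log_pos ((one_lt_div hδ).2 hδ1)
  have hsub : selected (B⁻¹ ^ 2) Γ x k ⊆ Finset.Icc 1 K :=
    (selected_subset _ _ _ _).trans (Finset.Icc_subset_Icc_right hk)
  have hxL : ∀ i ∈ selected (B⁻¹ ^ 2) Γ x k, ‖x i‖ ≤ L := fun i hi => (hx i (hsub hi)).1
  have hcard := card_selected_le hB hL hd hΓ hΓ1 hxL
  rw [← hι2] at hcard
  have hdet := log_det_gram_le hlam hd hxL
  set C := selected (B⁻¹ ^ 2) Γ x k with hC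
  have hA : Real.log (1 + C.card * L ^ 2 / (d * B⁻¹ ^ 2)) ≤
      Real.log (1 + 16 * L ^ 2 * B ^ 2 * Γ⁻¹ ^ 2 * iota2 d L B R Δ δ) := by
    refine Real.log_le_log (by positivity) ?_
    gcongr
    rw [div_le_iff₀ (by positivity)]
    calc C.card * L ^ 2 ≤ (16 * d * Γ⁻¹ ^ 2 * iota2 d L B R Δ δ) * L ^ 2 := by gcongr
      _ = _ := by field_simp
  have hA0 : 0 ≤ Real.log (1 + 16 * L ^ 2 * B ^ 2 * Γ⁻¹ ^ 2 * iota2 d L B R Δ δ) := by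
    have : 0 ≤ iota2 d L B R Δ δ := by linarith
    exact Real.log_nonneg (le_add_of_nonneg_right (by positivity))
  have hι30 : 0 ≤ iota3 d L B R Δ δ := by linarith
  -- The log-determinant ratio is at most d times the logarithm in `hA`, and d ≥ 1 lets 2d absorb
  -- the coefficients of both summands of ι₃.
  have hquad := hnoise.trans (c := (R * Real.sqrt (2 * d * iota3 d L B R Δ δ)) ^ 2) (by
    rw [mul_pow, Real.sq_sqrt (by positivity)]
    refine mul_le_mul_of_nonneg_left ?_ (sq_nonneg R)
    rw [Real.log_div (posDef_gram hlam x C).det_pos.ne' (by positivity), Real.log_pow, hι3]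
    nlinarith)
  have hthe : B⁻¹ ^ 2 * ‖θ‖ ^ 2 ≤ 1 ^ 2 := by
    rw [← mul_pow]
    refine pow_le_pow_left₀ (by positivity) ?_ 2
    rw [inv_mul_le_iff₀ hB0, mul_one]
    exact hθ
  have h := abs_inner_ridge_sub_le (x := x) (C := C) hlam (θ := θ)
    (y := fun i => r (x i) + ε i) (η := fun i => r (x i) - inner ℝ (x i) θ) (e := ε)
    (fun i _ => by ring) zero_le_one hthe hζ (fun i hi => (hx i (hsub hi)).2) (by positivity)
    hquad v
  refine h.trans (mul_le_mul_of_nonneg_right ?_ (wnorm_nonneg _ _))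
  rw [hrad]
  -- The factors Γ² and Γ⁻² cancel; the misspecification error becomes a term of β.
  have hz : ζ * Real.sqrt C.card ≤ 4 * Real.sqrt (d * iota2 d L B R Δ δ) := by
    refine abs_le_of_sq_le_sq' ?_ (by positivity) |>.2
    rw [mul_pow, mul_pow, Real.sq_sqrt (Nat.cast_nonneg _),
      Real.sq_sqrt (mul_nonneg (by linarith) (by linarith))]
    calc ζ ^ 2 * C.card ≤ Γ ^ 2 * (16 * d * Γ⁻¹ ^ 2 * iota2 d L B R Δ δ) := by gcongr
      _ = _ := by field_simp; norm_num
  linarith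

/-- The regret of a run on which the self-normalized noise is controlled in every round. -/
theorem regret_le_of_quadForm_le (hd : 1 ≤ d) (hL : 1 ≤ L) (hB : 1 ≤ B) (hR : 0 ≤ R)
    (hΔ : 0 < Δ) (hΔ1 : Δ ≤ 1) (hδ : 0 < δ) (hδ1 : δ < 1) (hθ : ‖θ‖ ≤ B) (hζ : 0 ≤ ζ)
    (hζΓ : ζ ≤ threshold d L B R Δ δ)
    (hD : ∀ k ∈ Finset.Icc 1 K, ∀ v ∈ D k,
      ‖v‖ ≤ L ∧ 0 ≤ r v ∧ r v ≤ 1 ∧ |r v - inner ℝ v θ| ≤ ζ)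
    (hgap : ∀ k ∈ Finset.Icc 1 K, ∀ v ∈ D k, 0 < optReward r (D k) - r v →
      Δ ≤ optReward r (D k) - r v)
    (hrun : IsRun (B⁻¹ ^ 2) (threshold d L B R Δ δ) (radius d L B R Δ δ) K D x
      (fun k => r (x k) + ε k))
    (hnoise : ∀ k ≤ K, weightedSum x ε (selected (B⁻¹ ^ 2) (threshold d L B R Δ δ) x k) ⬝ᵥ
          ((gram (B⁻¹ ^ 2) x (selected (B⁻¹ ^ 2) (threshold d L B R Δ δ) x k))⁻¹ *ᵥ
            weightedSum x ε (selected (B⁻¹ ^ 2) (threshold d L B R Δ δ) x k)) ≤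
      R ^ 2 * (Real.log ((gram (B⁻¹ ^ 2) x
          (selected (B⁻¹ ^ 2) (threshold d L B R Δ δ) x k)).det / (B⁻¹ ^ 2) ^ d) +
        2 * Real.log (1 / δ))) :
    regret r K D x ≤ (2 * radius d L B R Δ δ + 2) * Real.sqrt (sampleBound d L B R Δ δ *
      (2 * d * Real.log (1 + L ^ 2 * B ^ 2 * sampleBound d L B R Δ δ))) := by
  have hΓ := threshold_pos (δ := δ) hd hL hB hR hΔ hΔ1
  have hΓ1 := threshold_le_one (δ := δ) hd hL hB hR hΔ hΔ1
  have hβ := nine_le_radius (δ := δ) hd hL hB hR hΔ hΔ1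
  have hN := sampleBound_nonneg (δ := δ) hd hL hB hR hΔ hΔ1
  have hB0 : 0 < B := by linarith
  have hd' : (1 : ℝ) ≤ d := by exact_mod_cast hd
  have hx : ∀ i ∈ Finset.Icc 1 K, ‖x i‖ ≤ L ∧ |r (x i) - inner ℝ (x i) θ| ≤ ζ := fun i hi =>
    ⟨(hD i hi _ (hrun i hi).1).1, (hD i hi _ (hrun i hi).1).2.2.2⟩
  have hcard : ((selected (B⁻¹ ^ 2) (threshold d L B R Δ δ) x K).card : ℝ) ≤
      sampleBound d L B R Δ δ :=
    card_selected_le hB hL hd hΓ hΓ1 fun i hi => (hx i (selected_subset _ _ _ _ hi)).1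
  refine (regret_le_of_forall_abs_inner_sub_le (by positivity) hd (by linarith) hζΓ hrun hD hgap
    (two_mul_radius_mul_threshold_lt hd hL hB hR hΔ hΔ1 hδ hδ1 hζΓ) ?_).trans ?_
  · intro k hk v
    -- The estimate of round j + 1 uses the rounds selected up to j, so the noise bound is needed at
    -- j.
    obtain ⟨j, rfl⟩ : ∃ j, k = j + 1 := ⟨k - 1, by rw [Finset.mem_Icc] at hk; omega⟩
    have hj : j ≤ K := by rw [Finset.mem_Icc] at hk; omega
    exact abs_inner_estimate_sub_le hd hL hB hR hΔ hΔ1 hδ hδ1 hθ hζ hζΓ hx hj (hnoise j hj) v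
  · have hlog : Real.log (1 + (selected (B⁻¹ ^ 2) (threshold d L B R Δ δ) x K).card * L ^ 2 /
          (d * B⁻¹ ^ 2)) ≤ Real.log (1 + L ^ 2 * B ^ 2 * sampleBound d L B R Δ δ) := by
      refine Real.log_le_log (by positivity) ?_
      gcongr
      rw [div_le_iff₀ (by positivity)]
      calc _ ≤ sampleBound d L B R Δ δ * L ^ 2 := by gcongr
        _ ≤ d * (sampleBound d L B R Δ δ * L ^ 2) := le_mul_of_one_le_left (by positivity) hd'
        _ = _ := by field_simp
    have h0 : 0 ≤ Real.log (1 + (selected (B⁻¹ ^ 2) (threshold d L B R Δ δ) x K).card * L ^ 2 /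
        (d * B⁻¹ ^ 2)) := Real.log_nonneg (le_add_of_nonneg_right (by positivity))
    gcongr

theorem two_mul_radius_add_two_le_regretBound (hd : 1 ≤ d) (hL : 1 ≤ L) (hB : 1 ≤ B) (hR : 0 ≤ R)
    (hΔ : 0 < Δ) (hΔ1 : Δ ≤ 1) :
    (2 * radius d L B R Δ δ + 2) * Real.sqrt (sampleBound d L B R Δ δ *
      (2 * d * Real.log (1 + L ^ 2 * B ^ 2 * sampleBound d L B R Δ δ))) ≤
      regretBound (L ^ 2 * B ^ 2) d L B R Δ δ := by
  have hβ := nine_le_radius (δ := δ) hd hL hB hR hΔ hΔ1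
  rw [regretBound_eq hd hL hB hR hΔ hΔ1]
  gcongr
  linarith

/-- If LB ≤ N then 1 + L²B²N ≤ (1 + N)³, which costs a factor √3 ≤ 9/5. The slack between 2β + 2 and
4β pays for it exactly when β ≥ 9. -/
theorem two_mul_radius_add_two_le_regretBound_one (hd : 1 ≤ d) (hL : 1 ≤ L) (hB : 1 ≤ B)
    (hR : 0 ≤ R) (hΔ : 0 < Δ) (hΔ1 : Δ ≤ 1) (h : L * B ≤ sampleBound d L B R Δ δ) :
    (2 * radius d L B R Δ δ + 2) * Real.sqrt (sampleBound d L B R Δ δ *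
      (2 * d * Real.log (1 + L ^ 2 * B ^ 2 * sampleBound d L B R Δ δ))) ≤
      regretBound 1 d L B R Δ δ := by
  have hβ := nine_le_radius (δ := δ) hd hL hB hR hΔ hΔ1
  rw [regretBound_eq hd hL hB hR hΔ hΔ1, one_mul]
  have hLB : 1 ≤ L * B := one_le_mul_of_one_le_of_one_le hL hB
  set N := sampleBound d L B R Δ δ
  have hN : 1 ≤ N := hLB.trans h
  set β := radius d L B R Δ δ
  have hlog : Real.log (1 + L ^ 2 * B ^ 2 * N) ≤ 3 * Real.log (1 + N) := by
    rw [← mul_pow, show (3 : ℝ) = (3 : ℕ) by norm_num, ← Real.log_pow]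
    refine Real.log_le_log (by positivity) ?_
    have : (L * B) ^ 2 * N ≤ N ^ 2 * N := by gcongr
    nlinarith
  have hl0 : 0 ≤ Real.log (1 + N) := Real.log_nonneg (by linarith)
  have h1 : Real.sqrt (N * (2 * d * Real.log (1 + L ^ 2 * B ^ 2 * N))) ≤
      9 / 5 * Real.sqrt (N * (2 * d * Real.log (1 + N))) := by
    refine Real.sqrt_le_iff.2 ⟨by positivity, ?_⟩
    rw [mul_pow, Real.sq_sqrt (by positivity)]
    calc N * (2 * d * Real.log (1 + L ^ 2 * B ^ 2 * N)) ≤ N * (2 * d * (3 * Real.log (1 + N))) := by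
          gcongr
      _ ≤ _ := by nlinarith [show 0 ≤ N * (d * Real.log (1 + N)) by positivity]
  calc _ ≤ (2 * β + 2) * (9 / 5 * Real.sqrt (N * (2 * d * Real.log (1 + N)))) :=
        mul_le_mul_of_nonneg_left h1 (by linarith)
    _ = (18 / 5 * β + 18 / 5) * Real.sqrt (N * (2 * d * Real.log (1 + N))) := by ring
    _ ≤ _ := mul_le_mul_of_nonneg_right (by linarith) (Real.sqrt_nonneg _)

end Confidence

/-! ### Consequences of the minimal gap -/

section Gap

variable {Ω : Type*} {d K : ℕ} {r : Vec d → ℝ} {D : ℕ → Ω → Set (Vec d)} {Δ : ℝ}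

/-- A greatest lower bound of the empty set would be a largest real number. The witness also yields
Δ ≤ 1 and ζ ≥ 0. -/
theorem IsMinGap.exists_gap (h : IsMinGap r K D Δ) :
    ∃ k ∈ Finset.Icc 1 K, ∃ ω, ∃ v ∈ D k ω, 0 < optReward r (D k ω) - r v := by
  by_contra! hne
  have : {g : ℝ | 0 < g ∧ ∃ k ∈ Finset.Icc 1 K, ∃ ω, ∃ v ∈ D k ω,
      g = optReward r (D k ω) - r v} = ∅ := by
    rw [Set.eq_empty_iff_forall_notMem]
    rintro _ ⟨h0, k, hk, ω, v, hv, rfl⟩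
    exact absurd h0 (not_lt.2 (hne k hk ω v hv))
  unfold IsMinGap at h
  rw [this, isGLB_empty_iff] at h
  exact not_isTop Δ h

theorem IsMinGap.le (h : IsMinGap r K D Δ) {k : ℕ} (hk : k ∈ Finset.Icc 1 K) {ω : Ω} {v : Vec d}
    (hv : v ∈ D k ω) (h0 : 0 < optReward r (D k ω) - r v) : Δ ≤ optReward r (D k ω) - r v :=
  h.1 ⟨h0, k, hk, ω, v, hv, rfl⟩

theorem IsMinGap.le_one (h : IsMinGap r K D Δ)
    (hr : ∀ k ∈ Finset.Icc 1 K, ∀ ω, ∀ v ∈ D k ω, 0 ≤ r v ∧ r v ≤ 1) : Δ ≤ 1 := by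
  obtain ⟨k, hk, ω, v, hv, h0⟩ := h.exists_gap
  have h1 : optReward r (D k ω) ≤ 1 := by
    refine csSup_le ⟨r v, v, hv, rfl⟩ ?_
    rintro _ ⟨w, hw, rfl⟩
    exact (hr k hk ω w hw).2
  linarith [h.le hk hv h0, (hr k hk ω v hv).1]

end Gap

/-- The regret bound of DS-OFUL, with probability at least `1 - δ`, before simplification. -/
theorem measure_regret_gt_le {Ω : Type*} [MeasurableSpace Ω] (μ : Measure Ω)
    [IsProbabilityMeasure μ] {d K : ℕ} {L B R ζ Δ δ : ℝ} (hd : 1 ≤ d) (hL : 1 ≤ L) (hB : 1 ≤ B)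
    (hR : 0 ≤ R) (hδ : 0 < δ) (hδ1 : δ < 1) {D : ℕ → Ω → Set (Vec d)} {r : Vec d → ℝ} {θ : Vec d}
    (hθ : ‖θ‖ ≤ B)
    (hD : ∀ k ∈ Finset.Icc 1 K, ∀ ω, ∀ v ∈ D k ω,
      ‖v‖ ≤ L ∧ 0 ≤ r v ∧ r v ≤ 1 ∧ |r v - inner ℝ v θ| ≤ ζ)
    (hgap : IsMinGap r K D Δ) (hΔ : 0 < Δ) {x : ℕ → Ω → Vec d} {ε : ℕ → Ω → ℝ}
    (hmeas : ∀ k ∈ Finset.Icc 1 K, Measurable (x k) ∧ Measurable (ε k))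
    (hsub : ∀ k ∈ Finset.Icc 1 K, CondSubGaussian (history x ε k) μ R (ε k))
    (hrun : ∀ ω, IsRun (B⁻¹ ^ 2) (threshold d L B R Δ δ) (radius d L B R Δ δ) K
      (fun k => D k ω) (fun k => x k ω) (fun k => r (x k ω) + ε k ω))
    (hζ : 2 * Real.sqrt d * ζ * iota1 d L B R Δ δ ≤ Δ) {b : ℝ}
    (hb : (2 * radius d L B R Δ δ + 2) * Real.sqrt (sampleBound d L B R Δ δ *
      (2 * d * Real.log (1 + L ^ 2 * B ^ 2 * sampleBound d L B R Δ δ))) ≤ b) :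
    μ {ω | ¬ regret r K (fun k => D k ω) (fun k => x k ω) ≤ b} ≤ ENNReal.ofReal δ := by
  have hΔ1 : Δ ≤ 1 := hgap.le_one fun k hk ω v hv => ⟨(hD k hk ω v hv).2.1, (hD k hk ω v hv).2.2.1⟩
  have hζ0 : 0 ≤ ζ := by
    obtain ⟨k, hk, ω, v, hv, -⟩ := hgap.exists_gap
    exact (abs_nonneg _).trans (hD k hk ω v hv).2.2.2
  have hζΓ := le_threshold_of_le hd hL hB hR hΔ hΔ1 hζ
  have hB0 : 0 < B := by linarith
  -- The decision sets carry no measurability, so the failure event is only bounded in outer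
  -- measure, by inclusion in the noise event.
  refine (measure_mono fun ω hω => ?_).trans (measure_exists_lt_quadForm_le
    (lam := B⁻¹ ^ 2) (Γ := threshold d L B R Δ δ) (by positivity) hδ hmeas hsub)
  by_contra hno
  simp only [Set.mem_ofPred_eq, not_exists, not_and, not_lt] at hno
  exact hω ((regret_le_of_quadForm_le hd hL hB hR hΔ hΔ1 hδ hδ1 hθ hζ0 hζΓ
    (fun k hk v hv => hD k hk ω v hv) (fun k hk v hv h0 => hgap.le hk hv h0) (hrun ω)
    hno).trans hb)

/-! ### The order of the regret bound -/

section Asymptotics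

variable {d : ℕ} {L B R Δ δ : ℝ}

theorem log_one_div_le (hd : 1 ≤ d) (hL : 1 ≤ L) (hB : 1 ≤ B) (hR : 0 ≤ R) (hΔ : 0 < Δ)
    (hΔ1 : Δ ≤ 1) (hδ : 0 < δ) :
    Real.log (1 / δ) ≤ Real.log (2 + (1 + R) * d * L * B / (Δ * δ)) := by
  have hd' : (1 : ℝ) ≤ d := by exact_mod_cast hd
  refine Real.log_le_log (by positivity) ?_
  have hi : 1 ≤ Δ⁻¹ := (one_le_inv₀ hΔ).2 hΔ1
  have : 1 / δ ≤ (1 + R) * d * L * B / (Δ * δ) := by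
    calc 1 / δ = 1 * 1 * 1 * 1 * 1 * (1 / δ) := by ring
      _ ≤ (1 + R) * d * L * B * Δ⁻¹ * (1 / δ) := by gcongr; linarith
      _ = _ := by field_simp
  linarith

theorem log_natCast_le (hL : 1 ≤ L) (hB : 1 ≤ B) (hR : 0 ≤ R) (hd : 1 ≤ d) (hΔ : 0 < Δ)
    (hΔ1 : Δ ≤ 1) (hδ : 0 < δ) (hδ1 : δ < 1) :
    Real.log d ≤ Real.log (2 + (1 + R) * d * L * B / (Δ * δ)) := by
  have hd' : (1 : ℝ) ≤ d := by exact_mod_cast hd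
  refine Real.log_le_log (by linarith) ?_
  have hi : 1 ≤ (Δ * δ)⁻¹ := (one_le_inv₀ (by positivity)).2 (by nlinarith)
  have : (d : ℝ) ≤ (1 + R) * d * L * B / (Δ * δ) := by
    calc (d : ℝ) = 1 * d * 1 * 1 * 1 := by ring
      _ ≤ (1 + R) * d * L * B * (Δ * δ)⁻¹ := by gcongr; linarith
      _ = _ := rfl
  linarith

theorem log_gap_le (hd : 1 ≤ d) (hL : 1 ≤ L) (hB : 1 ≤ B) (hR : 0 ≤ R) (hΔ : 0 < Δ)
    (hδ : 0 < δ) (hδ1 : δ < 1) :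
    Real.log ((72 + 54 * R) * L * B * Real.sqrt d * Δ⁻¹) ≤
      5 * Real.log (2 + (1 + R) * d * L * B / (Δ * δ)) := by
  have hd' : (1 : ℝ) ≤ d := by exact_mod_cast hd
  have hsd : Real.sqrt d ≤ d := Real.sqrt_le_iff.2 ⟨by linarith, by nlinarith⟩
  have hsd0 : 0 < Real.sqrt d := Real.sqrt_pos.2 (by linarith)
  have hi : 1 ≤ δ⁻¹ := (one_le_inv₀ hδ).2 hδ1.le
  have hT : (72 + 54 * R) * L * B * Real.sqrt d * Δ⁻¹ ≤
      72 * ((1 + R) * d * L * B / (Δ * δ)) := by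
    calc (72 + 54 * R) * L * B * Real.sqrt d * Δ⁻¹
        = (72 + 54 * R) * L * B * Real.sqrt d * Δ⁻¹ * 1 := (mul_one _).symm
      _ ≤ 72 * (1 + R) * L * B * d * Δ⁻¹ * δ⁻¹ := by gcongr; linarith
      _ = _ := by field_simp
  have hT1 : 0 ≤ (1 + R) * d * L * B / (Δ * δ) := by positivity
  set T := (1 + R) * d * L * B / (Δ * δ)
  rw [show (5 : ℝ) = (5 : ℕ) by norm_num, ← Real.log_pow]
  refine Real.log_le_log (by positivity) (hT.trans ?_)
  -- The number 80 = 5·2⁴ is the linear coefficient of (2 + T)⁵, so the fifth power dominates 72T.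
  have : 80 * T ≤ (2 + T) ^ 4 * (2 + T) := by
    have h4 : 16 + 32 * T + 24 * T ^ 2 + 8 * T ^ 3 ≤ (2 + T) ^ 4 := by nlinarith [pow_nonneg hT1 4]
    nlinarith [pow_nonneg hT1 2, pow_nonneg hT1 3, pow_nonneg hT1 4, pow_nonneg hT1 5]
  calc 72 * T ≤ 80 * T := by linarith
    _ ≤ (2 + T) ^ 4 * (2 + T) := this
    _ = (2 + T) ^ 5 := by ring

theorem one_le_log_two_add (hd : 1 ≤ d) (hL : 1 ≤ L) (hB : 1 ≤ B) (hR : 0 ≤ R) (hΔ : 0 < Δ)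
    (hΔ1 : Δ ≤ 1) (hδ : 0 < δ) (hδ1 : δ < 1) :
    1 ≤ Real.log (2 + (1 + R) * d * L * B / (Δ * δ)) := by
  have hd' : (1 : ℝ) ≤ d := by exact_mod_cast hd
  have : 1 ≤ (1 + R) * d * L * B / (Δ * δ) := by
    rw [le_div_iff₀ (by positivity), one_mul]
    calc Δ * δ ≤ 1 := by nlinarith
      _ = 1 * 1 * 1 * 1 := by norm_num
      _ ≤ _ := by gcongr; linarith
  exact (Real.le_log_iff_exp_le (by linarith)).2 (by linarith [Real.exp_one_lt_three])

theorem sqrt_log_one_div_le (hd : 1 ≤ d) (hL : 1 ≤ L) (hB : 1 ≤ B) (hR : 0 ≤ R) (hΔ : 0 < Δ)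
    (hΔ1 : Δ ≤ 1) (hδ : 0 < δ) (hδ1 : δ < 1) :
    Real.sqrt (8 * R ^ 2 * Real.log (1 / δ)) ≤
      3 * (1 + R) * Real.log (2 + (1 + R) * d * L * B / (Δ * δ)) := by
  have h1 := one_le_log_two_add hd hL hB hR hΔ hΔ1 hδ hδ1
  have hℓ := log_one_div_le hd hL hB hR hΔ hΔ1 hδ
  set Λ := Real.log (2 + (1 + R) * d * L * B / (Δ * δ))
  have hℓ0 : 0 ≤ Real.log (1 / δ) := Real.log_nonneg ((one_le_div hδ).2 hδ1.le)
  refine Real.sqrt_le_iff.2 ⟨by positivity, ?_⟩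
  calc 8 * R ^ 2 * Real.log (1 / δ) ≤ 9 * (1 + R) ^ 2 * Λ ^ 2 := by
        gcongr
        · norm_num
        · linarith
        · nlinarith
    _ = _ := by ring

theorem iota1_le (hd : 1 ≤ d) (hL : 1 ≤ L) (hB : 1 ≤ B) (hR : 0 ≤ R) (hΔ : 0 < Δ) (hΔ1 : Δ ≤ 1)
    (hδ : 0 < δ) (hδ1 : δ < 1) :
    iota1 d L B R Δ δ ≤ 123 * (1 + R) * Real.log (2 + (1 + R) * d * L * B / (Δ * δ)) := by
  have hX := log_gap_le hd hL hB hR hΔ hδ hδ1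
  have hs := sqrt_log_one_div_le hd hL hB hR hΔ hΔ1 hδ hδ1
  have h1 := one_le_log_two_add hd hL hB hR hΔ hΔ1 hδ hδ1
  have := mul_le_mul_of_nonneg_left hX (by linarith : 0 ≤ 24 + 18 * R)
  unfold iota1
  nlinarith

theorem iota2_le_log (hd : 1 ≤ d) (hL : 1 ≤ L) (hB : 1 ≤ B) (hR : 0 ≤ R) (hΔ : 0 < Δ)
    (hΔ1 : Δ ≤ 1) (hδ : 0 < δ) (hδ1 : δ < 1) :
    iota2 d L B R Δ δ ≤ 11 * Real.log (2 + (1 + R) * d * L * B / (Δ * δ)) := by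
  have h := iota2_le (δ := δ) hd hL hB hR hΔ hΔ1
  have hX := log_gap_le hd hL hB hR hΔ hδ hδ1
  have hs := sqrt_log_one_div_le hd hL hB hR hΔ hΔ1 hδ hδ1
  have h1 := one_le_log_two_add hd hL hB hR hΔ hΔ1 hδ hδ1
  have : Real.sqrt (8 * R ^ 2 * Real.log (1 / δ)) / (24 + 18 * R) ≤
      Real.log (2 + (1 + R) * d * L * B / (Δ * δ)) := by
    rw [div_le_iff₀ (by positivity)]
    nlinarith
  linarith

theorem iota3_le (hd : 1 ≤ d) (hL : 1 ≤ L) (hB : 1 ≤ B) (hR : 0 ≤ R) (hΔ : 0 < Δ) (hΔ1 : Δ ≤ 1)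
    (hδ : 0 < δ) (hδ1 : δ < 1) :
    iota3 d L B R Δ δ ≤ 34 * Real.log (2 + (1 + R) * d * L * B / (Δ * δ)) := by
  rw [iota3_eq hd hL hB hR hΔ hΔ1 hδ]
  linarith [log_one_add_le_three_mul_iota2 (δ := δ) hd hL hB hR hΔ hΔ1,
    iota2_le_log hd hL hB hR hΔ hΔ1 hδ hδ1, log_one_div_le hd hL hB hR hΔ hΔ1 hδ]

theorem log_one_add_sampleBound_le (hd : 1 ≤ d) (hL : 1 ≤ L) (hB : 1 ≤ B) (hR : 0 ≤ R)
    (hΔ : 0 < Δ) (hΔ1 : Δ ≤ 1) (hδ : 0 < δ) (hδ1 : δ < 1) :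
    Real.log (1 + L ^ 2 * B ^ 2 * sampleBound d L B R Δ δ) ≤
      34 * Real.log (2 + (1 + R) * d * L * B / (Δ * δ)) := by
  have hd' : (1 : ℝ) ≤ d := by exact_mod_cast hd
  have hι := four_le_iota2 (δ := δ) hd hL hB hR hΔ hΔ1
  have hι0 : 0 ≤ iota2 d L B R Δ δ := by linarith
  have hz : 0 ≤ 16 * L ^ 2 * B ^ 2 * ((threshold d L B R Δ δ)⁻¹) ^ 2 * iota2 d L B R Δ δ := by
    positivity
  have h : 1 + L ^ 2 * B ^ 2 * sampleBound d L B R Δ δ ≤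
      d * (1 + 16 * L ^ 2 * B ^ 2 * ((threshold d L B R Δ δ)⁻¹) ^ 2 * iota2 d L B R Δ δ) := by
    rw [sampleBound]
    linarith
  have hN := sampleBound_nonneg (δ := δ) hd hL hB hR hΔ hΔ1
  have h2 := Real.log_le_log (by positivity) h
  rw [Real.log_mul (by positivity) (by positivity)] at h2
  linarith [log_one_add_le_three_mul_iota2 (δ := δ) hd hL hB hR hΔ hΔ1,
    iota2_le_log hd hL hB hR hΔ hΔ1 hδ hδ1, log_natCast_le hL hB hR hd hΔ hΔ1 hδ hδ1]

theorem radius_le (hd : 1 ≤ d) (hL : 1 ≤ L) (hB : 1 ≤ B) (hR : 0 ≤ R) (hΔ : 0 < Δ) (hΔ1 : Δ ≤ 1)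
    (hδ : 0 < δ) (hδ1 : δ < 1) :
    radius d L B R Δ δ ≤
      17 * (1 + R) * Real.sqrt d * Real.log (2 + (1 + R) * d * L * B / (Δ * δ)) := by
  have h1 := one_le_log_two_add hd hL hB hR hΔ hΔ1 hδ hδ1
  have h2 := iota2_le_log hd hL hB hR hΔ hΔ1 hδ hδ1
  have h3 := iota3_le hd hL hB hR hΔ hΔ1 hδ hδ1
  set Λ := Real.log (2 + (1 + R) * d * L * B / (Δ * δ))
  have hd' : (1 : ℝ) ≤ d := by exact_mod_cast hd
  have hsd : 1 ≤ Real.sqrt d := Real.one_le_sqrt.2 hd'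
  have hΛ : 1 ≤ Real.sqrt d * Λ := one_le_mul_of_one_le_of_one_le hsd h1
  have hsq : (Real.sqrt d * Λ) ^ 2 = d * Λ ^ 2 := by
    rw [mul_pow, Real.sq_sqrt (by linarith)]
  have hΛ2 : Λ ≤ Λ ^ 2 := by nlinarith
  have h4 : Real.sqrt (d * iota2 d L B R Δ δ) ≤ 4 * (Real.sqrt d * Λ) := by
    refine Real.sqrt_le_iff.2 ⟨by positivity, ?_⟩
    rw [mul_pow, hsq]
    calc d * iota2 d L B R Δ δ ≤ d * (11 * Λ ^ 2) := by gcongr; linarith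
      _ ≤ _ := by nlinarith [show 0 ≤ d * Λ ^ 2 by positivity]
  have h5 : Real.sqrt (2 * d * iota3 d L B R Δ δ) ≤ 9 * (Real.sqrt d * Λ) := by
    refine Real.sqrt_le_iff.2 ⟨by positivity, ?_⟩
    rw [mul_pow, hsq]
    calc 2 * d * iota3 d L B R Δ δ ≤ 2 * d * (34 * Λ ^ 2) := by gcongr; linarith
      _ ≤ _ := by nlinarith [show 0 ≤ d * Λ ^ 2 by positivity]
  have h6 := mul_le_mul_of_nonneg_left h5 hR
  have h7 : 0 ≤ R * (Real.sqrt d * Λ) := by positivity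
  unfold radius
  linarith

/-- With Λ the logarithm on the right, β, the square root and ι₁ each contribute one factor Λ. The
constant is 32·17·28·123, and 28² ≥ 2·11·34 accounts for the root. -/
theorem regretBound_le (hd : 1 ≤ d) (hL : 1 ≤ L) (hB : 1 ≤ B) (hR : 0 ≤ R) (hΔ : 0 < Δ)
    (hΔ1 : Δ ≤ 1) (hδ : 0 < δ) (hδ1 : δ < 1) :
    regretBound (L ^ 2 * B ^ 2) d L B R Δ δ ≤ 1873536 * (1 + R) ^ 2 * (d ^ 2 / Δ) *
      Real.log (2 + (1 + R) * d * L * B / (Δ * δ)) ^ 3 := by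
  have h1 := one_le_log_two_add hd hL hB hR hΔ hΔ1 hδ hδ1
  have hι1 := iota1_le hd hL hB hR hΔ hΔ1 hδ hδ1
  have hι10 := le_iota1 (δ := δ) hd hL hB hR hΔ hΔ1
  have hι2 := iota2_le_log hd hL hB hR hΔ hΔ1 hδ hδ1
  have hι20 := four_le_iota2 (δ := δ) hd hL hB hR hΔ hΔ1
  have hlog := log_one_add_sampleBound_le hd hL hB hR hΔ hΔ1 hδ hδ1
  have hβ := radius_le hd hL hB hR hΔ hΔ1 hδ hδ1
  have hN := sampleBound_nonneg (δ := δ) hd hL hB hR hΔ hΔ1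
  set Λ := Real.log (2 + (1 + R) * d * L * B / (Δ * δ))
  have hl0 : 0 ≤ Real.log (1 + L ^ 2 * B ^ 2 * sampleBound d L B R Δ δ) :=
    Real.log_nonneg (le_add_of_nonneg_right (by positivity))
  have hd0 : (0 : ℝ) ≤ d := Nat.cast_nonneg _
  have hsqrt : Real.sqrt (2 * d ^ 3 * iota2 d L B R Δ δ *
      Real.log (1 + L ^ 2 * B ^ 2 * sampleBound d L B R Δ δ)) ≤ 28 * (d * Real.sqrt d) * Λ := by
    refine Real.sqrt_le_iff.2 ⟨by positivity, ?_⟩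
    rw [mul_pow, mul_pow, mul_pow, Real.sq_sqrt hd0]
    calc _ ≤ 2 * (d : ℝ) ^ 3 * (11 * Λ) * (34 * Λ) := by gcongr
      _ ≤ _ := by nlinarith [show 0 ≤ (d : ℝ) ^ 3 * Λ ^ 2 by positivity]
  unfold regretBound
  calc _ ≤ 32 * (17 * (1 + R) * Real.sqrt d * Λ) * (28 * (d * Real.sqrt d) * Λ) *
        (123 * (1 + R) * Λ) / Δ := by gcongr
    _ = 1873536 * (1 + R) ^ 2 * (d * Real.sqrt d ^ 2 / Δ) * Λ ^ 3 := by ring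
    _ = _ := by rw [Real.sq_sqrt hd0, ← sq]

end Asymptotics

end DSOFUL

theorem theorem1 :
    -- the regret bound, with probability at least `1 - δ`
    (∀ {Ω : Type*} [MeasurableSpace Ω] (μ : Measure Ω) [IsProbabilityMeasure μ]
        (d : ℕ) (_ : 1 ≤ d) (K : ℕ)
        (L B R ζ Δ δ : ℝ) (_ : 1 ≤ L) (_ : 1 ≤ B) (_ : 0 ≤ R) (_ : 0 < δ) (_ : δ < 1)
        -- the bandit: decision sets, expected reward, misspecified linear model, gap
        (D : ℕ → Ω → Set (DSOFUL.Vec d)) (r : DSOFUL.Vec d → ℝ) (θ : DSOFUL.Vec d)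
        (_ : ‖θ‖ ≤ B)
        (_ : ∀ k ∈ Finset.Icc 1 K, ∀ ω, ∀ v ∈ D k ω,
          ‖v‖ ≤ L ∧ 0 ≤ r v ∧ r v ≤ 1 ∧ |r v - inner ℝ v θ| ≤ ζ)
        (_ : DSOFUL.IsMinGap r K D Δ) (_ : 0 < Δ)
        -- the chosen arms and the noise
        (x : ℕ → Ω → DSOFUL.Vec d) (ε : ℕ → Ω → ℝ)
        (_ : ∀ k ∈ Finset.Icc 1 K, Measurable (x k) ∧ Measurable (ε k))
        (_ : ∀ k ∈ Finset.Icc 1 K,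
          DSOFUL.CondSubGaussian (DSOFUL.history x ε k) μ R (ε k))
        -- the arms are chosen by the algorithm, with `λ = B⁻²` and the stated `Γ` and `β`
        (_ : ∀ ω, DSOFUL.IsRun (B⁻¹ ^ 2) (DSOFUL.threshold d L B R Δ δ)
          (DSOFUL.radius d L B R Δ δ) K (fun k => D k ω) (fun k => x k ω)
          (fun k => r (x k ω) + ε k ω))
        -- the misspecification level is small
        (_ : 2 * Real.sqrt d * ζ * DSOFUL.iota1 d L B R Δ δ ≤ Δ),
      μ {ω | ¬ DSOFUL.regret r K (fun k => D k ω) (fun k => x k ω) ≤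
          DSOFUL.regretBound (L ^ 2 * B ^ 2) d L B R Δ δ} ≤ ENNReal.ofReal δ ∧
      (L * B ≤ DSOFUL.sampleBound d L B R Δ δ →
        μ {ω | ¬ DSOFUL.regret r K (fun k => D k ω) (fun k => x k ω) ≤
          DSOFUL.regretBound 1 d L B R Δ δ} ≤ ENNReal.ofReal δ)) ∧
    -- the bound is `d² / Δ` up to logarithmic factors and the noise level
    (∃ C : ℝ, 0 < C ∧ ∃ p : ℕ, ∀ (d : ℕ) (L B R Δ δ : ℝ), 1 ≤ d → 1 ≤ L → 1 ≤ B → 0 ≤ R →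
      0 < Δ → Δ ≤ 1 → 0 < δ → δ < 1 →
      DSOFUL.regretBound (L ^ 2 * B ^ 2) d L B R Δ δ ≤
        C * (1 + R) ^ 2 * (d ^ 2 / Δ) *
          Real.log (2 + (1 + R) * d * L * B / (Δ * δ)) ^ p) := by
  refine ⟨?_, 1873536, by norm_num, 3, ?_⟩
  · intro Ω _ μ _ d hd K L B R ζ Δ δ hL hB hR hδ hδ1 D r θ hθ hD hgap hΔ x ε hmeas hsub hrun hζ
    have hΔ1 : Δ ≤ 1 := hgap.le_one fun k hk ω v hv =>
      ⟨(hD k hk ω v hv).2.1, (hD k hk ω v hv).2.2.1⟩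
    exact ⟨DSOFUL.measure_regret_gt_le μ hd hL hB hR hδ hδ1 hθ hD hgap hΔ hmeas hsub hrun hζ
        (DSOFUL.two_mul_radius_add_two_le_regretBound hd hL hB hR hΔ hΔ1),
      fun h => DSOFUL.measure_regret_gt_le μ hd hL hB hR hδ hδ1 hθ hD hgap hΔ hmeas hsub hrun hζ
        (DSOFUL.two_mul_radius_add_two_le_regretBound_one hd hL hB hR hΔ hΔ1 h)⟩
  · intro d L B R Δ δ hd hL hB hR hΔ hΔ1 hδ hδ1
    exact DSOFUL.regretBound_le hd hL hB hR hΔ hΔ1 hδ hδ1
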